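/- Let $d\ge 0$ and let $\mathbb{Z}^d$ (discrete) act on a locally compact Hausdorff space $X$, properly in the sense of Bourbaki: the map $\mathbb{Z}^d\times X\to X\times X$, $(g,x)\mapsto (gx,x)$, is proper. Let $\pi\colon X\to X/\mathbb{Z}^d$ be the quotient map. Let $\mathcal{F}$ be a $\mathbb{Z}^d$-equivariant sheaf of abelian groups on $X$, i.e. a sheaf with isomorphisms $\mathcal{F}(U)\cong\mathcal{F}(gU)$ for $g\in\mathbb{Z}^d$ and $U\subseteq X$ open, compatible with restrictions and with the multiplication of the group. A family of supports on $X$ is a family of closed subsets that is closed under finite unions and contains, along with a set, all of its closed subsets. Let $\Phi$ be the smallest family of supports that contains all the sets $K\cdot\mathbb{Z}^d=\bigcup_{g\in\mathbb{Z}^d} gK$ with $K\subseteq X$ compact. Assume that $\mathcal{F}$ is $\Phi$-soft: for every $C\in\Phi$, every section over $C$ of the restriction $\mathcal{F}|_C$ extends to a global section of $\mathcal{F}$. Let $\Gamma_c(\mathcal{F})$ be the group of global sections of $\mathcal{F}$ with compact support, with the induced action of $\mathbb{Z}^d$, and let $\mathcal{F}/\mathbb{Z}^d:=(\pi_*\mathcal{F})^{\mathbb{Z}^d}$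 be the sheaf on $X/\mathbb{Z}^d$ whose sections over an open set $U$ are the $\mathbb{Z}^d$-invariant sections of $\mathcal{F}$ over $\pi^{-1}(U)$. Then, as abelian groups, $$H^p\left(\mathbb{Z}^d,\ \Gamma_c(\mathcal{F})\right)\cong\begin{cases}\Gamma_c\left(X/\mathbb{Z}^d,\ \mathcal{F}/\mathbb{Z}^d\right)&\text{if }p=d,\\ 0&\text{if }p\ne d,\end{cases}$$ where $H^p$ is group cohomology and $\Gamma_c\left(X/\mathbb{Z}^d,\ \cdot\right)$ is the group of global sections with compact support. -/

import Mathlib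

open CategoryTheory TopologicalSpace Opposite

universe u

noncomputable section

/-! ### Supports and sections with compact support -/

/-- The support of a global section of an abelian sheaf: the points at which its germ is nonzero. -/
def sectionSupport {X : TopCat.{u}} (F : TopCat.Sheaf AddCommGrpCat.{u} X)
    (s : F.presheaf.obj (op ⊤)) : Set X :=
  {x | F.presheaf.germ ⊤ x trivial s ≠ 0}

theorem isClosed_sectionSupport {X : TopCat.{u}} (F : TopCat.Sheaf AddCommGrpCat.{u} X)
    (s : F.presheaf.obj (op ⊤)) : IsClosed (sectionSupport F s) := by
  rw [← isOpen_compl_iff, isOpen_iff_forall_mem_open]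
  intro x hx
  have hx' : F.presheaf.germ ⊤ x trivial s = F.presheaf.germ ⊤ x trivial 0 := by
    rw [map_zero]
    simpa [sectionSupport] using hx
  obtain ⟨W, hxW, iU, iV, h⟩ := F.presheaf.germ_eq x (Opens.mem_top x) (Opens.mem_top x) s 0 hx'
  refine ⟨W, fun y hy => ?_, W.isOpen, hxW⟩
  have h2 := congrArg (F.presheaf.germ W y hy) h
  rw [TopCat.Presheaf.germ_res_apply, TopCat.Presheaf.germ_res_apply, map_zero] at h2
  simpa [sectionSupport] using h2

/-- `Γ_c(X, F)`: the group of global sections of `F` with compact support. -/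
def compactSections {X : TopCat.{u}} (F : TopCat.Sheaf AddCommGrpCat.{u} X) :
    AddSubgroup (F.presheaf.obj (op ⊤)) where
  carrier := {s | IsCompact (sectionSupport F s)}
  zero_mem' := by
    have : sectionSupport F 0 = ∅ := by
      ext x
      simp [sectionSupport]
    simp [this]
  add_mem' := by
    intro s t hs ht
    refine (IsCompact.union hs ht).of_isClosed_subset (isClosed_sectionSupport F _) ?_
    intro x hx
    by_contra h
    simp only [sectionSupport, Set.mem_union, Set.mem_ofPred_eq, not_or, not_not] at h hx
    exact hx (by rw [map_add, h.1, h.2, add_zero])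
  neg_mem' := by
    intro s hs
    have : sectionSupport F (-s) = sectionSupport F s := by
      ext x
      simp [sectionSupport]
    simpa [this] using hs

/-! ### Families of supports and softness -/

/-- A family of supports on `X`: a family of closed sets that is closed under finite unions (the
empty union included) and contains, along with a set, all of its closed subsets. -/
structure IsFamilyOfSupports {X : Type u} [TopologicalSpace X] (Φ : Set (Set X)) : Prop where
  isClosed : ∀ A ∈ Φ, IsClosed A
  empty_mem : ∅ ∈ Φ
  union_mem : ∀ A ∈ Φ, ∀ B ∈ Φ, A ∪ B ∈ Φ
  subset_mem : ∀ A ∈ Φ, ∀ B : Set X, IsClosed B → B ⊆ A → B ∈ Φ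

/-- The family of supports generated by a family `Θ` of closed sets: the smallest family of
supports that contains `Θ`. -/
def generatedSupports {X : Type u} [TopologicalSpace X] (Θ : Set (Set X)) : Set (Set X) :=
  {A | ∀ Φ : Set (Set X), IsFamilyOfSupports Φ → Θ ⊆ Φ → A ∈ Φ}

/-- A choice of a germ `s x` of `F` at every point `x` of the subset `C` is a section of `F` over
`C` (that is, a section of the restriction `F|_C`, a continuous section over `C` of the étalé space
of `F`) if, locally on `C`, it is induced by sections of `F` over open subsets of `X`. -/
def IsSectionOver {X : TopCat.{u}} (F : TopCat.Sheaf AddCommGrpCat.{u} X) (C : Set X)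
    (s : ∀ x : C, F.presheaf.stalk x.1) : Prop :=
  ∀ x : C, ∃ (U : Opens X) (_ : x.1 ∈ U) (t : F.presheaf.obj (op U)),
    ∀ (y : C) (hy : y.1 ∈ U), s y = F.presheaf.germ U y.1 hy t

/-- `F` is `Φ`-soft if every section of `F` over a member of `Φ` extends to a global section. -/
def IsSoft {X : TopCat.{u}} (Φ : Set (Set X)) (F : TopCat.Sheaf AddCommGrpCat.{u} X) : Prop :=
  ∀ C ∈ Φ, ∀ s : (∀ x : C, F.presheaf.stalk x.1), IsSectionOver F C s →
    ∃ t : F.presheaf.obj (op ⊤), ∀ x : C, s x = F.presheaf.germ ⊤ x.1 trivial t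

/-- The family of the sets `K · G` with `K ⊆ X` compact. -/
def compactSweeps (G : Type u) [Group G] (X : Type u) [TopologicalSpace X] [MulAction G X] :
    Set (Set X) :=
  {A | ∃ K : Set X, IsCompact K ∧ A = {x | ∃ g : G, ∃ k ∈ K, g • k = x}}

/-! ### Equivariant sheaves -/

/-- A `G`-equivariant abelian sheaf on `X`, for a (discrete) group `G` that acts on `X`: an abelian
sheaf `F` with isomorphisms `F(U) ≅ F(gU)`, compatible with restriction and with the multiplication
of `G`. The isomorphism is recorded together with its composites with restrictions: `act g` maps
`F(U)` to `F(V)` for all opens `U` and `V` with `V ⊆ gU`. In this form `act 1` is the restriction,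
and naturality as well as invertibility follow from `act_one` and `act_mul`. -/
structure EquivariantSheaf (G : Type u) [Group G] (X : Type u) [TopologicalSpace X]
    [MulAction G X] where
  sheaf : TopCat.Sheaf AddCommGrpCat.{u} (TopCat.of X)
  act : ∀ (g : G) {U V : Opens X}, (∀ x ∈ V, g⁻¹ • x ∈ U) →
    (sheaf.presheaf.obj (op U) →+ sheaf.presheaf.obj (op V))
  act_one : ∀ {U V : Opens X} (i : V ⟶ U) (h : ∀ x ∈ V, (1 : G)⁻¹ • x ∈ U)
    (s : sheaf.presheaf.obj (op U)), act 1 h s = sheaf.presheaf.map i.op s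
  act_mul : ∀ (g h : G) {U V W : Opens X} (hUV : ∀ x ∈ V, h⁻¹ • x ∈ U)
    (hVW : ∀ x ∈ W, g⁻¹ • x ∈ V) (hUW : ∀ x ∈ W, (g * h)⁻¹ • x ∈ U)
    (s : sheaf.presheaf.obj (op U)), act (g * h) hUW s = act g hVW (act h hUV s)

namespace EquivariantSheaf

variable {G : Type u} [Group G] {X : Type u} [TopologicalSpace X] [MulAction G X]
  (F : EquivariantSheaf G X)

theorem map_act (g : G) {U V W : Opens X} (i : W ⟶ V) (hUV : ∀ x ∈ V, g⁻¹ • x ∈ U)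
    (hUW : ∀ x ∈ W, g⁻¹ • x ∈ U) (s : F.sheaf.presheaf.obj (op U)) :
    F.sheaf.presheaf.map i.op (F.act g hUV s) = F.act g hUW s := by
  have h1 : ∀ x ∈ W, (1 : G)⁻¹ • x ∈ V := fun x hx => by simpa using i.le hx
  rw [← F.act_one i h1, ← F.act_mul 1 g hUV h1 (by simpa using hUW)]
  congr 2
  simp

theorem act_map (g : G) {U V W : Opens X} (i : V ⟶ U) (hVW : ∀ x ∈ W, g⁻¹ • x ∈ V)
    (hUW : ∀ x ∈ W, g⁻¹ • x ∈ U) (s : F.sheaf.presheaf.obj (op U)) :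
    F.act g hVW (F.sheaf.presheaf.map i.op s) = F.act g hUW s := by
  have h1 : ∀ x ∈ V, (1 : G)⁻¹ • x ∈ U := fun x hx => by simpa using i.le hx
  rw [← F.act_one i h1, ← F.act_mul g 1 h1 hVW (by simpa using hUW)]
  congr 2
  simp

theorem inv_smul_mem_top (g : G) (x : X) (_ : x ∈ (⊤ : Opens X)) : g⁻¹ • x ∈ (⊤ : Opens X) :=
  Opens.mem_top _

/-! #### The representation on compactly supported sections -/

theorem sectionSupport_act_subset [ContinuousConstSMul G X] (g : G)
    (h : ∀ x ∈ (⊤ : Opens X), g⁻¹ • x ∈ (⊤ : Opens X)) (s : F.sheaf.presheaf.obj (op ⊤)) :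
    sectionSupport F.sheaf (F.act g h s) ⊆ (fun x : X => g • x) '' sectionSupport F.sheaf s := by
  intro x hx
  refine ⟨g⁻¹ • (show X from x), ?_, smul_inv_smul g (show X from x)⟩
  intro h0
  apply hx
  have h0' : F.sheaf.presheaf.germ ⊤ (g⁻¹ • (show X from x)) trivial s =
      F.sheaf.presheaf.germ ⊤ (g⁻¹ • (show X from x)) trivial 0 := by
    rw [map_zero]
    exact h0
  obtain ⟨W, hxW, iU, iV, hW⟩ := F.sheaf.presheaf.germ_eq _ (Opens.mem_top _) (Opens.mem_top _) s 0 h0'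
  let W' : Opens X := ⟨(fun y : X => g⁻¹ • y) ⁻¹' W, W.isOpen.preimage (continuous_const_smul _)⟩
  have hWW : ∀ y ∈ W', g⁻¹ • y ∈ W := fun y hy => hy
  have hTW : ∀ y ∈ W', g⁻¹ • y ∈ (⊤ : Opens X) := fun y _ => trivial
  have key : F.sheaf.presheaf.map (homOfLE (le_top : W' ≤ ⊤)).op (F.act g h s) = 0 := by
    rw [F.map_act g _ h hTW, ← F.act_map g iU hWW hTW, hW, map_zero, map_zero]
  rw [← F.sheaf.presheaf.germ_res_apply (homOfLE (le_top : W' ≤ ⊤)) x hxW, key, map_zero]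

theorem act_mem_compactSections [ContinuousConstSMul G X] (g : G)
    (h : ∀ x ∈ (⊤ : Opens X), g⁻¹ • x ∈ (⊤ : Opens X)) (s : F.sheaf.presheaf.obj (op ⊤))
    (hs : s ∈ compactSections F.sheaf) : F.act g h s ∈ compactSections F.sheaf :=
  (IsCompact.image (show IsCompact (sectionSupport F.sheaf s) from hs)
    (continuous_const_smul g)).of_isClosed_subset
    (isClosed_sectionSupport F.sheaf _) (F.sectionSupport_act_subset g h s)

/-- The action of `G` on `Γ_c(X, F)`. The coefficient ring is a copy of `ℤ` in the universe of the
data, as is needed to form the group cohomology. -/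
def compactSectionsRho [ContinuousConstSMul G X] :
    Representation (ULift.{u} ℤ) G (compactSections F.sheaf) where
  toFun g :=
    { toFun := fun s => ⟨F.act g (inv_smul_mem_top _) s.1,
        F.act_mem_compactSections g (inv_smul_mem_top _) s.1 s.2⟩
      map_add' := fun s t => Subtype.ext (map_add _ s.1 t.1)
      map_smul' := fun n s => Subtype.ext (map_zsmul (F.act g (inv_smul_mem_top _)) n.down s.1) }
  map_one' := by
    ext s
    refine (F.act_one (𝟙 ⊤) (inv_smul_mem_top _) s.1).trans ?_
    simp
  map_mul' g h := by
    ext s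
    exact F.act_mul g h (inv_smul_mem_top _) (inv_smul_mem_top _) (inv_smul_mem_top _) s.1

/-- `Γ_c(X, F)` as a `G`-module. -/
def compactSectionsRep [ContinuousConstSMul G X] : Rep.{u} (ULift.{u} ℤ) G :=
  Rep.of F.compactSectionsRho

/-! #### The sheaf of invariants on the orbit space -/

/-- The preimage in `X` of an open subset of the orbit space `X/G` (with the quotient topology). -/
def orbitPreimage (U : Opens (MulAction.orbitRel.Quotient G X)) : Opens X :=
  U.comap ⟨Quotient.mk (MulAction.orbitRel G X), continuous_quotient_mk'⟩

theorem inv_smul_mem_orbitPreimage (U : Opens (MulAction.orbitRel.Quotient G X)) (g : G) (x : X)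
    (hx : x ∈ orbitPreimage U) : g⁻¹ • x ∈ orbitPreimage U := by
  have : (Quotient.mk (MulAction.orbitRel G X) (g⁻¹ • x)) =
      Quotient.mk (MulAction.orbitRel G X) x := Quotient.sound ⟨g⁻¹, rfl⟩
  change Quotient.mk (MulAction.orbitRel G X) (g⁻¹ • x) ∈ U
  rw [this]
  exact hx

/-- The `G`-invariant sections of `F` over the preimage of `U ⊆ X/G`. -/
def invariantSections (U : Opens (MulAction.orbitRel.Quotient G X)) :
    AddSubgroup (F.sheaf.presheaf.obj (op (orbitPreimage U))) where
  carrier := {s | ∀ g : G, F.act g (inv_smul_mem_orbitPreimage U g) s = s}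
  zero_mem' := fun _ => map_zero _
  add_mem' := fun hs ht g => by rw [map_add, hs g, ht g]
  neg_mem' := fun hs g => by rw [map_neg, hs g]

/-- The inclusion of preimages of open subsets of the orbit space. -/
def orbitPreimageHom {U V : Opens (MulAction.orbitRel.Quotient G X)} (i : V ⟶ U) :
    orbitPreimage V ⟶ orbitPreimage U :=
  homOfLE fun _ hx => i.le hx

/-- The presheaf `U ↦ F(π⁻¹ U)^G` on the orbit space, `π : X → X/G` the quotient map. -/
def invariantsPresheaf :
    TopCat.Presheaf AddCommGrpCat.{u} (TopCat.of (MulAction.orbitRel.Quotient G X)) where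
  obj U := AddCommGrpCat.of (F.invariantSections U.unop)
  map {U V} i := AddCommGrpCat.ofHom
    (((F.sheaf.presheaf.map (orbitPreimageHom i.unop).op).hom.comp
      (F.invariantSections U.unop).subtype).codRestrict (F.invariantSections V.unop) (by
        intro s g
        have h : ∀ x ∈ orbitPreimage V.unop, g⁻¹ • x ∈ orbitPreimage U.unop := fun x hx =>
          i.unop.le (inv_smul_mem_orbitPreimage V.unop g x hx)
        refine (F.act_map g (orbitPreimageHom i.unop) _ h s.1).trans ?_
        rw [← F.map_act g (orbitPreimageHom i.unop) (inv_smul_mem_orbitPreimage U.unop g) h, s.2 g]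
        rfl))
  map_id U := by
    ext s
    exact congrArg (fun f => f.hom s.1) (F.sheaf.presheaf.map_id (op (orbitPreimage U.unop)))
  map_comp {U V W} i j := by
    ext s
    exact congrArg (fun f => f.hom s.1)
      (F.sheaf.presheaf.map_comp (orbitPreimageHom i.unop).op (orbitPreimageHom j.unop).op)

theorem isSheaf_invariantsPresheaf : F.invariantsPresheaf.IsSheaf := by
  rw [TopCat.Presheaf.isSheaf_iff_isSheafUniqueGluing]
  intro ι U sf hsf
  have hcover : orbitPreimage (iSup U) ≤ ⨆ i, orbitPreimage (U i) := by
    intro x hx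
    obtain ⟨i, hi⟩ := Opens.mem_iSup.1 (show Quotient.mk (MulAction.orbitRel G X) x ∈ iSup U from hx)
    exact Opens.mem_iSup.2 ⟨i, hi⟩
  let iUV : ∀ i, orbitPreimage (U i) ⟶ orbitPreimage (iSup U) :=
    fun i => orbitPreimageHom (Opens.leSupr U i)
  have hcompat : TopCat.Presheaf.IsCompatible F.sheaf.presheaf (fun i => orbitPreimage (U i))
      (fun i => (sf i).1) := fun i j => congrArg Subtype.val (hsf i j)
  obtain ⟨s, hs, huniq⟩ := F.sheaf.existsUnique_gluing' (fun i => orbitPreimage (U i))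
    (orbitPreimage (iSup U)) iUV hcover (fun i => (sf i).1) hcompat
  have hinv : s ∈ F.invariantSections (iSup U) := by
    intro g
    refine huniq _ fun i => ?_
    have h : ∀ x ∈ orbitPreimage (U i), g⁻¹ • x ∈ orbitPreimage (iSup U) := fun x hx =>
      (iUV i).le (inv_smul_mem_orbitPreimage (U i) g x hx)
    refine (F.map_act g (iUV i) _ h s).trans ?_
    rw [← F.act_map g (iUV i) (inv_smul_mem_orbitPreimage (U i) g) h, hs i]
    exact (sf i).2 g
  refine ⟨⟨s, hinv⟩, fun i => Subtype.ext (hs i), fun t ht => Subtype.ext ?_⟩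
  exact huniq t.1 fun i => congrArg Subtype.val (ht i)

/-- The sheaf `F/G = (π_* F)^G` of invariants on the orbit space `X/G`. -/
def invariants :
    TopCat.Sheaf AddCommGrpCat.{u} (TopCat.of (MulAction.orbitRel.Quotient G X)) :=
  ⟨F.invariantsPresheaf, F.isSheaf_invariantsPresheaf⟩

end EquivariantSheaf

end

/-! Write `G` for `ℤ^d`, `M` for `Γ_c(F)`, and `I_H M` for the span of the elements `h s - s` with
`h` in a subgroup `H`, so that `M_H = M / I_H M` is the module of coinvariants. Properness makes
stabilizers finite, and `G` is torsion-free, so the action is free. It also makes the norm `N_H s =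
∑_{h ∈ H} h s` a locally finite sum, hence a global section.

Softness enters through a cutoff lemma (`exists_cutoff`): sections can be cut down to neighbourhoods
of compact sets. Combined with finite covers by compact sets whose neighbourhoods have disjoint
translates, it gives two facts: the kernel of `N_H` is exactly `I_H M` (`mem_ker_of_norm_eq_zero`),
and every `H`-invariant section supported in the `H`-sweep of a compact set is a norm
(`exists_norm_eq`). For `H = G` these say that the norm induces `M_G ≅ Γ_c(X/G, F/G)`.

Let `H_i` be spanned by the first `i` basis elements and let `t` be the next one. If `t s - s` lies
in `I_{H_i} M`, then `N_{H_i} s` is `t`-invariant. A nonzero germ of it would bring one point into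
the compact support of `s` by infinitely many group elements, so `N_{H_i} s = 0` and `s` lies in
`I_{H_i} M` (`norm_eq_zero_of_sub_mem_ker`). Thus `t - 1` is injective on `M_{H_i}`, with cokernel
`M_{H_{i+1}}`: the operators `t - 1` form a regular sequence.

A commutative group acts trivially on its cohomology (`map_applyAsHom`), so `t - 1` induces zero
there and the long exact sequences break up. They give vanishing below degree `d` and `H^d(G, M) ≅
H^0(G, M_G) = M_G`. Above degree `d` the cohomology of every `G`-module vanishes
(`isZero_groupCohomology_of_lt`). -/

noncomputable section

/-! ### Exact sequences of representations and coinduction. -/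

namespace Rep

open Limits

theorem shortExact_of_function_exact {k G : Type u} [CommRing k] [Group G]
    {S : ShortComplex (Rep.{u} k G)} (hf : Function.Injective S.f.hom)
    (hfg : Function.Exact S.f.hom S.g.hom) (hg : Function.Surjective S.g.hom) : S.ShortExact where
  exact := by
    refine (ShortComplex.exact_map_iff_of_faithful S (forget₂ (Rep k G) (ModuleCat k))).1 ?_
    rw [ShortComplex.moduleCat_exact_iff]
    exact fun x hx => (hfg x).1 hx
  mono_f := (mono_iff_injective _).2 hf
  epi_g := (epi_iff_surjective _).2 hg

section

variable {k G : Type u} [CommRing k] [Group G]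

/-- The embedding of a representation into the coinduction of its restriction to a subgroup. -/
def toCoind (S : Subgroup G) (A : Rep.{u} k G) :
    A ⟶ coind S.subtype (res S.subtype A) :=
  ofHom
    { toFun := fun a => ⟨fun g => A.ρ g a, fun s g => by simp⟩
      map_add' := fun a b => by ext; simp
      map_smul' := fun r a => by ext; simp
      isIntertwining' := fun g => by
        ext a x
        exact (LinearMap.congr_fun (map_mul A.ρ x g) a).symm }

@[simp]
theorem toCoind_apply (S : Subgroup G) (A : Rep.{u} k G) (a : A) (g : G) :
    ((toCoind S A).hom a).1 g = A.ρ g a := rfl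

theorem toCoind_injective (S : Subgroup G) (A : Rep.{u} k G) :
    Function.Injective (toCoind S A).hom := fun a b h => by
  have h1 := congrFun (congrArg Subtype.val h) 1
  rwa [toCoind_apply, toCoind_apply, map_one] at h1

end

/-! ### Cohomology of commutative groups and regular operators. -/

section Commutative

variable {k G : Type u} [CommRing k] [CommGroup G]

/-- Dimension shifting: in degree 0 the cohomology is the invariants, and for higher degrees `A`
embeds in a module coinduced from the trivial subgroup, which is acyclic, so that the connecting map
onto the cohomology of `A` is epi and natural. -/
theorem map_applyAsHom (A : Rep.{u} k G) (t : G) (n : ℕ) :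
    groupCohomology.map (MonoidHom.id G) (A.applyAsHom t) n = 𝟙 _ := by
  induction n generalizing A with
  | zero =>
    rw [← cancel_mono (groupCohomology.H0Iso A).hom, groupCohomology.map_id_comp_H0Iso_hom,
      Category.id_comp]
    convert! Category.comp_id _
    ext x
    exact Subtype.ext (x.2 t)
  | succ n ih =>
    let I := coind (⊥ : Subgroup G).subtype (res (⊥ : Subgroup G).subtype A)
    have : Mono (toCoind ⊥ A) := (mono_iff_injective _).2 (toCoind_injective _ _)
    let S : ShortComplex (Rep.{u} k G) :=
      ShortComplex.mk (toCoind ⊥ A) (cokernel.π (toCoind ⊥ A)) (cokernel.condition _)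
    have hS : S.ShortExact :=
      { exact := ShortComplex.exact_cokernel _
        mono_f := this
        epi_g := inferInstanceAs (Epi (cokernel.π _)) }
    let φ : S ⟶ S :=
      { τ₁ := S.X₁.applyAsHom t
        τ₂ := S.X₂.applyAsHom t
        τ₃ := S.X₃.applyAsHom t
        comm₁₂ := applyAsHom_comm _ _
        comm₂₃ := applyAsHom_comm _ _ }
    have hI : IsZero (groupCohomology I (n + 1)) :=
      (isZero_groupCohomology_succ_of_subsingleton _ n).of_iso (groupCohomology.coindIso _ _)
    have : Epi (groupCohomology.δ hS n (n + 1) rfl) := groupCohomology.epi_δ_of_isZero hS n hI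
    have h := groupCohomology.δ_naturality hS hS φ n (n + 1) rfl
    rw [← cancel_epi (groupCohomology.δ hS n (n + 1) rfl)]
    refine h.trans ?_
    rw [show φ.τ₃ = S.X₃.applyAsHom t from rfl, ih]
    exact (Category.id_comp _).trans (Category.comp_id _).symm

theorem map_applyAsHom_sub_id (A : Rep.{u} k G) (t : G) (n : ℕ) :
    groupCohomology.map (MonoidHom.id G) (A.applyAsHom t - 𝟙 A) n = 0 := by
  have h : (groupCohomology.cochainsFunctor k G ⋙ HomologicalComplex.homologyFunctor _ _ n).map
      (A.applyAsHom t - 𝟙 A) = 0 := by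
    rw [Functor.map_sub, CategoryTheory.Functor.map_id, sub_eq_zero]
    exact map_applyAsHom A t n
  exact h

section

variable {M Q : Rep.{u} k G} {t : G} {q : M ⟶ Q} {w : (M.applyAsHom t - 𝟙 M) ≫ q = 0}
  (hX : (ShortComplex.mk _ q w).ShortExact)

include hX

/-- The next map in the long exact sequence is induced by `t - 1`, hence zero. -/
theorem epi_δ_of_applyAsHom_sub_id (n : ℕ) : Epi (groupCohomology.δ hX n (n + 1) rfl) :=
  (groupCohomology.mapShortComplex₁_exact hX rfl).epi_f (map_applyAsHom_sub_id M t (n + 1))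

theorem isZero_succ_of_shortExact (n : ℕ) (h : IsZero (groupCohomology Q n)) :
    IsZero (groupCohomology M (n + 1)) := by
  have := epi_δ_of_applyAsHom_sub_id hX n
  exact IsZero.of_epi (groupCohomology.δ hX n (n + 1) rfl) h

/-- The map that `t - 1` induces on `H^0` is both mono and zero. -/
theorem isZero_zero_of_shortExact : IsZero (groupCohomology M 0) := by
  have h : Mono (M.applyAsHom t - 𝟙 M) := hX.mono_f
  have h2 := groupCohomology.mono_map_0_of_mono (M.applyAsHom t - 𝟙 M)
  rw [map_applyAsHom_sub_id] at h2
  exact IsZero.of_mono_zero _ (groupCohomology M 0)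

theorem nonempty_iso_of_shortExact (n : ℕ) (h : IsZero (groupCohomology M n)) :
    Nonempty (groupCohomology Q n ≅ groupCohomology M (n + 1)) := by
  have := epi_δ_of_applyAsHom_sub_id hX n
  have := groupCohomology.mono_δ_of_isZero hX n h
  have := isIso_of_mono_of_epi (groupCohomology.δ hX n (n + 1) rfl)
  exact ⟨asIso (groupCohomology.δ hX n (n + 1) rfl)⟩

end

section

variable {d : ℕ} {N : ℕ → Rep.{u} k G} {t : ℕ → G}
  (hN : ∀ i < d, ∃ (q : N i ⟶ N (i + 1)) (w : ((N i).applyAsHom (t i) - 𝟙 _) ≫ q = 0),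
    (ShortComplex.mk _ q w).ShortExact)

include hN

theorem isZero_groupCohomology_of_add_lt (p i : ℕ) (h : i + p < d) :
    IsZero (groupCohomology (N i) p) := by
  induction p generalizing i with
  | zero =>
    obtain ⟨q, w, hX⟩ := hN i (by omega)
    exact isZero_zero_of_shortExact hX
  | succ p ih =>
    obtain ⟨q, w, hX⟩ := hN i (by omega)
    exact isZero_succ_of_shortExact hX p (ih (i + 1) (by omega))

theorem nonempty_groupCohomology_iso_of_add_eq (p i : ℕ) (h : i + p = d) :
    Nonempty (groupCohomology (N i) p ≅ groupCohomology (N d) 0) := by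
  induction p generalizing i with
  | zero =>
    obtain rfl : i = d := by omega
    exact ⟨Iso.refl _⟩
  | succ p ih =>
    obtain ⟨q, w, hX⟩ := hN i (by omega)
    obtain ⟨f⟩ := nonempty_iso_of_shortExact hX p
      (isZero_groupCohomology_of_add_lt hN p i (by omega))
    obtain ⟨g⟩ := ih (i + 1) (by omega)
    exact ⟨f.symm ≪≫ g⟩

end

/-! ### Cohomological dimension of `ℤ^d`. -/

section Dimension

/-- For `t : G`, the endomorphism `f ↦ (x ↦ t f(t⁻¹ x) - f x)` of a coinduced representation of a
commutative group. -/
def coindDiff (S : Subgroup G) (A : Rep.{u} k G) (t : G) :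
    coind S.subtype (res S.subtype A) ⟶ coind S.subtype (res S.subtype A) :=
  ofHom
    { toFun := fun f => ⟨fun x => A.ρ t (f.1 (t⁻¹ * x)) - f.1 x, fun s x => by
        have h1 := f.2 s (t⁻¹ * x)
        have h2 := f.2 s x
        change A.ρ t (f.1 (t⁻¹ * (S.subtype s * x))) - f.1 (S.subtype s * x) = A.ρ s (_ - _)
        rw [mul_left_comm, h1, h2, map_sub]
        congr 1
        change (A.ρ t * A.ρ s) _ = (A.ρ s * A.ρ t) _
        rw [← map_mul, ← map_mul, mul_comm]⟩
      map_add' := fun a b => by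
        refine Subtype.ext (funext fun x => ?_)
        change A.ρ t (a.1 _ + b.1 _) - (a.1 _ + b.1 _) =
          (A.ρ t (a.1 _) - a.1 _) + (A.ρ t (b.1 _) - b.1 _)
        rw [map_add]
        abel
      map_smul' := fun r a => by
        refine Subtype.ext (funext fun x => ?_)
        change A.ρ t (r • a.1 _) - r • a.1 _ = r • (A.ρ t (a.1 _) - a.1 _)
        rw [map_smul, smul_sub]
      isIntertwining' := fun g => by
        ext f x
        change A.ρ t (f.1 (t⁻¹ * x * g)) - f.1 (x * g) = A.ρ t (f.1 (t⁻¹ * (x * g))) - f.1 (x * g)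
        rw [mul_assoc] }

theorem coindDiff_apply (S : Subgroup G) (A : Rep.{u} k G) (t : G)
    (f : coind S.subtype (res S.subtype A)) (x : G) :
    ((coindDiff S A t).hom f).1 x = A.ρ t (f.1 (t⁻¹ * x)) - f.1 x := rfl

/-- A discrete primitive, normalised by `F 0 = 0` and summed separately in the two directions. -/
theorem _root_.Int.exists_sub_eq {A : Type*} [AddCommGroup A] (a : ℤ → A) :
    ∃ F : ℤ → A, ∀ n, F (n - 1) - F n = a n := by
  refine ⟨fun n => Int.rec (fun n => -∑ i ∈ Finset.range n, a (i + 1))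
    (fun n => ∑ i ∈ Finset.range (n + 1), a (-i)) n, fun n => ?_⟩
  rcases n with (_ | n) | n
  · change ∑ i ∈ Finset.range (0 + 1), a (-(i : ℤ)) - -∑ i ∈ Finset.range 0, a ((i : ℤ) + 1) = _
    simp
  · have h : Int.ofNat (n + 1) - 1 = Int.ofNat n := by simp
    rw [h]
    change -∑ i ∈ Finset.range n, a ((i : ℤ) + 1) - -∑ i ∈ Finset.range (n + 1), a ((i : ℤ) + 1) = _
    rw [Finset.sum_range_succ]
    simp
  · have h : Int.negSucc n - 1 = Int.negSucc (n + 1) := by omega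
    rw [h]
    change ∑ i ∈ Finset.range (n + 1 + 1), a (-(i : ℤ)) - ∑ i ∈ Finset.range (n + 1), a (-(i : ℤ)) = _
    rw [Finset.sum_range_succ, add_sub_cancel_left]
    congr 1

variable (φ : G →* Multiplicative ℤ) {t : G} (ht : φ t = Multiplicative.ofAdd 1)

include ht

theorem exists_mul_zpow_of_map_eq (x : G) : ∃ s : φ.ker, x = s * t ^ (φ x).toAdd := by
  refine ⟨⟨x * (t ^ (φ x).toAdd)⁻¹, ?_⟩, by simp⟩
  rw [MonoidHom.mem_ker, map_mul, map_inv, map_zpow, ht, ← ofAdd_zsmul]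
  simp

/-- A function killed by `coindDiff` is equivariant under `t` as well as under `φ.ker`. These
generate `G`, so the function is `x ↦ x • f 1`. -/
theorem exact_toCoind_coindDiff (A : Rep.{u} k G) :
    Function.Exact (toCoind φ.ker A).hom (coindDiff φ.ker A t).hom := by
  intro f
  constructor
  · intro hf
    let K : Subgroup G :=
      { carrier := {g | ∀ y, f.1 (g * y) = A.ρ g (f.1 y)}
        one_mem' := fun y => by simp
        mul_mem' := fun {a b} ha hb y => by
          rw [mul_assoc, ha, hb, map_mul]
          rfl
        inv_mem' := fun {a} ha y => by
          have := ha (a⁻¹ * y)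
          rw [mul_inv_cancel_left] at this
          rw [this]
          simp }
    have htK : t ∈ K := fun y => by
      have h := congrFun (congrArg Subtype.val hf) (t * y)
      rw [coindDiff_apply, inv_mul_cancel_left] at h
      exact (sub_eq_zero.1 h).symm
    refine ⟨f.1 1, Subtype.ext (funext fun x => ?_)⟩
    obtain ⟨s, hs⟩ := exists_mul_zpow_of_map_eq φ ht x
    have hx : x ∈ K := by
      rw [hs]
      exact K.mul_mem (fun y => f.2 s y) (K.zpow_mem htK _)
    rw [toCoind_apply, ← hx 1, mul_one]
  · rintro ⟨a, rfl⟩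
    refine Subtype.ext (funext fun x => ?_)
    rw [coindDiff_apply, toCoind_apply, toCoind_apply]
    change (A.ρ t * A.ρ _) a - _ = 0
    rw [← map_mul, mul_inv_cancel_left, sub_self]

/-- Through `n ↦ t⁻ⁿ f(tⁿ)` the coinduced module becomes the functions on `G / φ.ker ≅ ℤ`, and
`coindDiff` becomes the difference operator `F (n - 1) - F n`. -/
theorem coindDiff_surjective (A : Rep.{u} k G) :
    Function.Surjective (coindDiff φ.ker A t).hom := by
  intro h
  obtain ⟨F, hF⟩ := Int.exists_sub_eq fun n : ℤ => A.ρ (t ^ n)⁻¹ (h.1 (t ^ n))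
  refine ⟨⟨fun x => A.ρ x (F (φ x).toAdd), fun s x => ?_⟩, Subtype.ext (funext fun x => ?_)⟩
  · have hs : φ s = 1 := s.2
    simp [hs]
  · rw [coindDiff_apply]
    change (A.ρ t * A.ρ _) _ - _ = _
    rw [← map_mul, mul_inv_cancel_left, ← map_sub, map_mul φ, map_inv, ht, toAdd_mul, toAdd_inv,
      toAdd_ofAdd, neg_add_eq_sub, hF]
    obtain ⟨s, hs⟩ := exists_mul_zpow_of_map_eq φ ht x
    change (A.ρ _ * A.ρ _) _ = _
    have h2 : x * (t ^ (φ x).toAdd)⁻¹ = s := by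
      rw [mul_inv_eq_iff_eq_mul, ← hs]
    rw [← map_mul, h2]
    exact (h.2 s (t ^ (φ x).toAdd)).symm.trans (congrArg h.1 hs.symm)

/-- By Shapiro's lemma the coinduced module has no cohomology above `n`. The sequence `0 → A → coind
→ coind → 0` then costs one degree. -/
theorem isZero_groupCohomology_of_isZero_ker {n : ℕ}
    (hn : ∀ (B : Rep.{u} k φ.ker) (p : ℕ), n < p → IsZero (groupCohomology B p))
    (A : Rep.{u} k G) (p : ℕ) (hp : n + 1 < p) : IsZero (groupCohomology A p) := by
  obtain ⟨q, rfl⟩ : ∃ q, p = q + 1 := ⟨p - 1, by omega⟩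
  have w : toCoind φ.ker A ≫ coindDiff φ.ker A t = 0 := by
    ext a x
    exact congrFun (congrArg Subtype.val
      ((exact_toCoind_coindDiff φ ht A).apply_apply_eq_zero a)) x
  have hX : (ShortComplex.mk _ _ w).ShortExact :=
    shortExact_of_function_exact (toCoind_injective _ _) (exact_toCoind_coindDiff φ ht A)
      (coindDiff_surjective φ ht A)
  have hI : ∀ r, n < r → IsZero (groupCohomology (coind φ.ker.subtype (res φ.ker.subtype A)) r) :=
    fun r hr => (hn _ r hr).of_iso (groupCohomology.coindIso _ _)
  have := groupCohomology.epi_δ_of_isZero hX q (hI _ (by omega))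
  exact IsZero.of_epi (groupCohomology.δ hX q (q + 1) rfl) (hI q (by omega))

end Dimension

end Commutative

/-- The group `ℤ^d` has cohomological dimension at most `d`. -/
theorem isZero_groupCohomology_of_lt {k : Type u} [CommRing k] (d : ℕ) {G : Type u} [CommGroup G]
    (e : G ≃* Multiplicative (Fin d → ℤ)) (A : Rep.{u} k G) (p : ℕ) (hp : d < p) :
    IsZero (groupCohomology A p) := by
  induction d generalizing G p with
  | zero =>
    have : Subsingleton G := e.toEquiv.subsingleton
    obtain ⟨q, rfl⟩ : ∃ q, p = q + 1 := ⟨p - 1, by omega⟩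
    exact isZero_groupCohomology_succ_of_subsingleton A q
  | succ d ih =>
    -- The induction splits off the coordinate 0; the kernel is free on the others.
    let φ : G →* Multiplicative ℤ :=
      { toFun := fun g => Multiplicative.ofAdd ((e g).toAdd 0)
        map_one' := by simp
        map_mul' := fun a b => by simp }
    let e' : φ.ker ≃* Multiplicative (Fin d → ℤ) :=
      { toFun := fun g => Multiplicative.ofAdd (Fin.tail (e g).toAdd)
        invFun := fun v => ⟨e.symm (Multiplicative.ofAdd (Fin.cons 0 v.toAdd)), by
          simp [MonoidHom.mem_ker, φ]⟩
        left_inv := fun g => by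
          refine Subtype.ext ?_
          have h : (e g).toAdd 0 = 0 := congrArg Multiplicative.toAdd (MonoidHom.mem_ker.1 g.2)
          refine (MulEquiv.symm_apply_eq _).2 ?_
          refine Multiplicative.toAdd.injective ?_
          simp only [toAdd_ofAdd]
          rw [← h, Fin.cons_self_tail]
        right_inv := fun v => by simp
        map_mul' := fun a b => by
          refine Multiplicative.toAdd.injective ?_
          ext i
          simp [Fin.tail] }
    refine isZero_groupCohomology_of_isZero_ker φ
      (t := e.symm (Multiplicative.ofAdd (Pi.single 0 1))) (by simp [φ]) (n := d)
      (fun B p hp => ih e' B p hp) A p hp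

end Rep

/-! ### Coinvariants by subgroups. -/

namespace Representation

variable {k G V : Type*} [CommRing k] [Group G] [AddCommGroup V] [Module k V]
  (ρ : Representation k G V)

theorem Coinvariants.sub_mem_ker_comp_subtype {S : Subgroup G} {g : G} (hg : g ∈ S) (v : V) :
    ρ g v - v ∈ Coinvariants.ker (ρ.comp S.subtype) :=
  Coinvariants.sub_mem_ker (ρ := ρ.comp S.subtype) ⟨g, hg⟩ v

theorem Coinvariants.ker_comp_subtype_le {S : Subgroup G} {P : Submodule k V}
    (h : ∀ g ∈ S, ∀ v, ρ g v - v ∈ P) : Coinvariants.ker (ρ.comp S.subtype) ≤ P :=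
  Submodule.span_le.2 fun _ ⟨⟨s, v⟩, hs⟩ => hs ▸ h s.1 s.2 v

theorem Coinvariants.ker_comp_subtype_mono {S T : Subgroup G} (h : S ≤ T) :
    Coinvariants.ker (ρ.comp S.subtype) ≤ Coinvariants.ker (ρ.comp T.subtype) :=
  ker_comp_subtype_le ρ fun _ hg v => sub_mem_ker_comp_subtype ρ (h hg) v

/-- The elements of `G` that act trivially modulo `P = I_S V + (t - 1) V` form a subgroup; it
contains `S` and `t`, so all relations for the larger group lie in `P`. -/
theorem Coinvariants.exists_of_mem_ker_sup_zpowers {S : Subgroup G} {t : G} {v : V}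
    (hv : v ∈ Coinvariants.ker (ρ.comp (S ⊔ Subgroup.zpowers t).subtype)) :
    ∃ w, v - (ρ t w - w) ∈ Coinvariants.ker (ρ.comp S.subtype) := by
  let P := Coinvariants.ker (ρ.comp S.subtype) ⊔ LinearMap.range (ρ t - LinearMap.id)
  let K : Subgroup G :=
    { carrier := {g | ∀ v, ρ g v - v ∈ P}
      one_mem' := fun v => by simp
      mul_mem' := fun {a b} ha hb v => by
        have h : ρ (a * b) v - v = (ρ a (ρ b v) - ρ b v) + (ρ b v - v) := by
          rw [map_mul, Module.End.mul_apply]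
          abel
        rw [h]
        exact P.add_mem (ha _) (hb _)
      inv_mem' := fun {a} ha v => by
        have h := P.neg_mem (ha (ρ a⁻¹ v))
        simpa using h }
  have hK : S ⊔ Subgroup.zpowers t ≤ K := by
    refine sup_le (fun g hg v => ?_) ((Subgroup.zpowers_le).2 fun v => ?_)
    · exact Submodule.mem_sup_left (sub_mem_ker_comp_subtype ρ hg v)
    · exact Submodule.mem_sup_right ⟨v, rfl⟩
  obtain ⟨a, ha, b, ⟨w, rfl⟩, rfl⟩ := Submodule.mem_sup.1
    (ker_comp_subtype_le ρ (P := P) (fun g hg => hK hg) hv)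
  exact ⟨w, by simpa using ha⟩

end Representation

namespace Rep

open Limits Representation

variable {k G : Type u} [CommRing k] [CommGroup G] (M : Rep.{u} k G)

/-- The projection between the coinvariants of a representation by two subgroups `S ≤ T`, as a
linear map. -/
def toCoinvariantsLinearMap {S T : Subgroup G} (h : S ≤ T) :
    Coinvariants (M.ρ.comp S.subtype) →ₗ[k] Coinvariants (M.ρ.comp T.subtype) :=
  Coinvariants.lift (M.ρ.comp S.subtype) (Coinvariants.mk (M.ρ.comp T.subtype)) fun s => by
    ext v
    exact (Coinvariants.mk_eq_iff _).2 (Coinvariants.sub_mem_ker_comp_subtype M.ρ (h s.2) v)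

theorem toCoinvariantsLinearMap_comp {S T : Subgroup G} (h : S ≤ T) (g : G) :
    M.toCoinvariantsLinearMap h ∘ₗ M.ρ.toCoinvariants S g =
      M.ρ.toCoinvariants T g ∘ₗ M.toCoinvariantsLinearMap h := by
  ext v
  simp only [LinearMap.comp_apply, toCoinvariants_mk]
  exact (toCoinvariants_mk M.ρ T g v).symm

/-- The projection between the coinvariants of a representation by two subgroups `S ≤ T`. -/
def toCoinvariantsMap {S T : Subgroup G} (h : S ≤ T) : M.toCoinvariants S ⟶ M.toCoinvariants T :=
  ofHom
    { toLinearMap := M.toCoinvariantsLinearMap h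
      isIntertwining' := M.toCoinvariantsLinearMap_comp h }

theorem toCoinvariantsMap_mk {S T : Subgroup G} (h : S ≤ T) (v : M) :
    (M.toCoinvariantsMap h).hom (Coinvariants.mk (M.ρ.comp S.subtype) v) =
      Coinvariants.mk (M.ρ.comp T.subtype) v := rfl

theorem applyAsHom_sub_id_mk (S : Subgroup G) (t : G) (v : M) :
    ((M.toCoinvariants S).applyAsHom t - 𝟙 _).hom (Coinvariants.mk (M.ρ.comp S.subtype) v) =
      Coinvariants.mk (M.ρ.comp S.subtype) (M.ρ t v - v) := rfl

/-- `hreg` is injectivity of `t - 1` on the coinvariants by `S`; its cokernel is the module of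
coinvariants by `S` and `t` together. -/
theorem exists_shortExact_toCoinvariants {S T : Subgroup G} {t : G}
    (hT : T = S ⊔ Subgroup.zpowers t)
    (hreg : ∀ v : M, M.ρ t v - v ∈ Coinvariants.ker (M.ρ.comp S.subtype) →
      v ∈ Coinvariants.ker (M.ρ.comp S.subtype)) :
    ∃ (q : M.toCoinvariants S ⟶ M.toCoinvariants T)
      (w : ((M.toCoinvariants S).applyAsHom t - 𝟙 _) ≫ q = 0),
      (ShortComplex.mk _ q w).ShortExact := by
  have hST : S ≤ T := hT ▸ le_sup_left
  have ht : t ∈ T := hT ▸ Subgroup.mem_sup_right (Subgroup.mem_zpowers t)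
  have hex : Function.Exact ((M.toCoinvariants S).applyAsHom t - 𝟙 _).hom
      (M.toCoinvariantsMap hST).hom := by
    intro x
    obtain ⟨v, rfl⟩ := Coinvariants.mk_surjective _ x
    rw [toCoinvariantsMap_mk]
    refine (Coinvariants.mk_eq_zero _).trans ⟨fun hv => ?_, ?_⟩
    · subst hT
      obtain ⟨w, hw⟩ := Coinvariants.exists_of_mem_ker_sup_zpowers M.ρ hv
      exact ⟨Coinvariants.mk _ w, ((Coinvariants.mk_eq_iff _).2 hw).symm⟩
    · rintro ⟨y, hy⟩
      obtain ⟨w, rfl⟩ := Coinvariants.mk_surjective _ y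
      rw [applyAsHom_sub_id_mk, Coinvariants.mk_eq_iff] at hy
      rw [← sub_sub_cancel (M.ρ t w - w) v]
      exact Submodule.sub_mem _ (Coinvariants.sub_mem_ker_comp_subtype M.ρ ht w)
        (Coinvariants.ker_comp_subtype_mono M.ρ hST hy)
  refine ⟨M.toCoinvariantsMap hST, ?_, shortExact_of_function_exact ?_ hex ?_⟩
  · refine hom_ext (Representation.IntertwiningMap.ext (LinearMap.ext fun x => ?_))
    exact hex.apply_apply_eq_zero x
  · refine (injective_iff_map_eq_zero _).2 fun x hx => ?_
    obtain ⟨v, rfl⟩ := Coinvariants.mk_surjective _ x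
    exact (Coinvariants.mk_eq_zero _).2 (hreg v ((Coinvariants.mk_eq_zero _).1 hx))
  · intro x
    obtain ⟨v, rfl⟩ := Coinvariants.mk_surjective _ x
    exact ⟨Coinvariants.mk _ v, rfl⟩

theorem nonempty_iso_toCoinvariants_bot : Nonempty (M ≅ M.toCoinvariants ⊥) := by
  have hker : Coinvariants.ker (M.ρ.comp (⊥ : Subgroup G).subtype) = ⊥ := by
    refine le_bot_iff.1 (Coinvariants.ker_comp_subtype_le M.ρ fun g hg v => ?_)
    rw [Subgroup.mem_bot.1 hg]
    simp
  have h1 : Mono (M.toCoinvariantsMkQ ⊥) := (mono_iff_injective _).2 <| by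
    refine (injective_iff_map_eq_zero _).2 fun x hx => ?_
    have h := (Coinvariants.mk_eq_zero _).1 hx
    rw [hker] at h
    exact h
  have h2 : Epi (M.toCoinvariantsMkQ ⊥) :=
    (epi_iff_surjective _).2 (Coinvariants.mk_surjective _)
  have := isIso_of_mono_of_epi (M.toCoinvariantsMkQ ⊥)
  exact ⟨asIso (M.toCoinvariantsMkQ ⊥)⟩

theorem nonempty_groupCohomology_zero_toCoinvariants_top :
    Nonempty (groupCohomology (M.toCoinvariants ⊤) 0 ≃+
      Coinvariants (M.ρ.comp (⊤ : Subgroup G).subtype)) := by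
  have h : (M.toCoinvariants ⊤).ρ.invariants = ⊤ := by
    refine eq_top_iff.2 fun x _ g => ?_
    obtain ⟨v, rfl⟩ := Coinvariants.mk_surjective _ x
    exact (Coinvariants.mk_eq_iff _).2
      (Coinvariants.sub_mem_ker_comp_subtype M.ρ (Subgroup.mem_top g) v)
  exact ⟨((groupCohomology.H0Iso (M.toCoinvariants ⊤)).toLinearEquiv.trans
    (LinearEquiv.ofTop _ h)).toAddEquiv⟩

/-- The cohomology of a representation of `ℤ^d` on which the operators `t i - 1` form a regular
sequence is concentrated in degree `d`. -/
theorem groupCohomology_of_regular {d : ℕ} (t : ℕ → G) (H : ℕ → Subgroup G) (h0 : H 0 = ⊥)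
    (hs : ∀ i < d, H (i + 1) = H i ⊔ Subgroup.zpowers (t i)) (hd : H d = ⊤)
    (hreg : ∀ i < d, ∀ v : M, M.ρ (t i) v - v ∈ Coinvariants.ker (M.ρ.comp (H i).subtype) →
      v ∈ Coinvariants.ker (M.ρ.comp (H i).subtype)) :
    (∀ p < d, IsZero (groupCohomology M p)) ∧
      Nonempty (groupCohomology M d ≃+ Coinvariants (M.ρ.comp (⊤ : Subgroup G).subtype)) := by
  have hN := fun i hi => M.exists_shortExact_toCoinvariants (hs i hi) (hreg i hi)
  obtain ⟨f⟩ : Nonempty (M ≅ M.toCoinvariants (H 0)) := by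
    rw [h0]
    exact M.nonempty_iso_toCoinvariants_bot
  constructor
  · intro p hp
    exact (isZero_groupCohomology_of_add_lt (N := fun i => M.toCoinvariants (H i)) hN p 0
      (by omega)).of_iso ((groupCohomology.functor k G p).mapIso f)
  · obtain ⟨a⟩ := nonempty_groupCohomology_iso_of_add_eq (N := fun i => M.toCoinvariants (H i)) hN
      d 0 (by omega)
    obtain ⟨b⟩ : Nonempty (groupCohomology (M.toCoinvariants (H d)) 0 ≃+
        Coinvariants (M.ρ.comp (⊤ : Subgroup G).subtype)) := by
      rw [hd]
      exact M.nonempty_groupCohomology_zero_toCoinvariants_top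
    exact ⟨((groupCohomology.functor k G d).mapIso f ≪≫ a).toLinearEquiv.toAddEquiv.trans b⟩

end Rep

/-! ### Germs, gluing and cutoffs for soft sheaves. -/

section Sheaf

variable {X : TopCat.{u}} (F : TopCat.Sheaf AddCommGrpCat.{u} X)

theorem IsSectionOver.exists_section {U : Opens X} {s : ∀ x : (U : Set X), F.presheaf.stalk x.1}
    (hs : IsSectionOver F (U : Set X) s) :
    ∃ t : F.presheaf.obj (op U), ∀ (x : X) (hx : x ∈ U), F.presheaf.germ U x hx t = s ⟨x, hx⟩ := by
  choose V hV t ht using hs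
  let W : ↥(U : Set X) → Opens X := fun x => V x ⊓ U
  let τ : ∀ x, F.presheaf.obj (op (W x)) := fun x =>
    F.presheaf.map (homOfLE (inf_le_left : V x ⊓ U ≤ V x)).op (t x)
  have hτ : ∀ x y (hy : y ∈ W x), F.presheaf.germ (W x) y hy (τ x) = s ⟨y, hy.2⟩ := by
    intro x y hy
    rw [ht x ⟨y, hy.2⟩ hy.1]
    exact F.presheaf.germ_res_apply _ _ _ _
  have hcompat : TopCat.Presheaf.IsCompatible F.presheaf W τ := by
    intro x y
    refine TopCat.Presheaf.section_ext F _ _ _ fun z hz => ?_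
    exact (F.presheaf.germ_res_apply _ z hz (τ x)).trans ((hτ x z hz.1).trans
      ((hτ y z hz.2).symm.trans (F.presheaf.germ_res_apply _ z hz (τ y)).symm))
  obtain ⟨r, hr, -⟩ := F.existsUnique_gluing' W U (fun x => homOfLE inf_le_right)
    (fun x hx => Opens.mem_iSup.2 ⟨⟨x, hx⟩, hV ⟨x, hx⟩, hx⟩) τ hcompat
  refine ⟨r, fun x hx => ?_⟩
  have hxW : x ∈ W ⟨x, hx⟩ := ⟨hV ⟨x, hx⟩, hx⟩
  rw [← hτ ⟨x, hx⟩ x hxW, ← hr ⟨x, hx⟩]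
  exact (F.presheaf.germ_res_apply _ x hxW r).symm

/-- The germ of a global section at a point, as a homomorphism. -/
def globalGerm (x : X) : F.presheaf.obj (op ⊤) →+ F.presheaf.stalk x :=
  (F.presheaf.germ ⊤ x trivial).hom

variable {F}

theorem globalGerm_ext {s t : F.presheaf.obj (op ⊤)}
    (h : ∀ x, globalGerm F x s = globalGerm F x t) : s = t :=
  TopCat.Presheaf.section_ext F _ _ _ fun x _ => h x

theorem exists_globalGerm_eq (s : ∀ x : X, F.presheaf.stalk x)
    (hs : ∀ x : X, ∃ (U : Opens X) (_ : x ∈ U) (t : F.presheaf.obj (op ⊤)),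
      ∀ y ∈ U, s y = globalGerm F y t) :
    ∃ t : F.presheaf.obj (op ⊤), ∀ x, globalGerm F x t = s x := by
  have h : IsSectionOver F ((⊤ : Opens X) : Set X) fun x => s x.1 := by
    intro x
    obtain ⟨U, hxU, t, ht⟩ := hs x.1
    refine ⟨U, hxU, F.presheaf.map (homOfLE (le_top : U ≤ ⊤)).op t, fun y hy => ?_⟩
    rw [TopCat.Presheaf.germ_res_apply]
    exact ht y.1 hy
  obtain ⟨t, ht⟩ := h.exists_section
  exact ⟨t, fun x => ht x trivial⟩

theorem exists_extension_of_globalGerm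
    (hF : ∀ C : Set X, IsCompact C → ∀ s : (∀ x : C, F.presheaf.stalk x.1), IsSectionOver F C s →
      ∃ t : F.presheaf.obj (op ⊤), ∀ x : C, s x = F.presheaf.germ ⊤ x.1 trivial t)
    {C : Set X} (hC : IsCompact C) (s : ∀ x : X, F.presheaf.stalk x)
    (hs : ∀ x ∈ C, ∃ (U : Opens X) (_ : x ∈ U) (t : F.presheaf.obj (op ⊤)),
      ∀ y ∈ C, y ∈ U → s y = globalGerm F y t) :
    ∃ t : F.presheaf.obj (op ⊤), ∀ x ∈ C, globalGerm F x t = s x := by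
  have h : IsSectionOver F C fun x => s x.1 := by
    intro x
    obtain ⟨U, hxU, t, ht⟩ := hs x.1 x.2
    refine ⟨U, hxU, F.presheaf.map (homOfLE (le_top : U ≤ ⊤)).op t, fun y hy => ?_⟩
    rw [TopCat.Presheaf.germ_res_apply]
    exact ht y.1 y.2 hy
  obtain ⟨t, ht⟩ := hF C hC _ h
  exact ⟨t, fun x hx => (ht ⟨x, hx⟩).symm⟩

/-- The zero set of a global section, as an open set. -/
def zeroLocus (s : F.presheaf.obj (op ⊤)) : Opens X :=
  ⟨(sectionSupport F s)ᶜ, (isClosed_sectionSupport F s).isOpen_compl⟩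

theorem mem_zeroLocus {s : F.presheaf.obj (op ⊤)} {x : X} :
    x ∈ zeroLocus s ↔ globalGerm F x s = 0 := not_not

open Classical in
/-- A section of a soft sheaf can be cut off to a section that is supported near a given compact
set, without enlarging the zero set. -/
theorem exists_cutoff [T2Space X] [LocallyCompactSpace X]
    (hF : ∀ C : Set X, IsCompact C → ∀ s : (∀ x : C, F.presheaf.stalk x.1), IsSectionOver F C s →
      ∃ t : F.presheaf.obj (op ⊤), ∀ x : C, s x = F.presheaf.germ ⊤ x.1 trivial t)
    (s : F.presheaf.obj (op ⊤)) {Z : Set X} (hZ : IsClosed Z) (hs : ∀ x ∈ Z, globalGerm F x s = 0)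
    {L U : Set X} (hL : IsCompact L) (hU : IsOpen U) (hLU : L ⊆ U) :
    ∃ r ∈ compactSections F, (∀ x, globalGerm F x r ≠ 0 → x ∈ U ∧ x ∉ Z) ∧
      ∀ x ∈ L, globalGerm F x r = globalGerm F x s := by
  obtain ⟨V, hV, hLV, hVU, hVc⟩ := exists_open_between_and_isCompact_closure hL hU hLU
  have hfr : IsCompact (frontier V) := hVc.of_isClosed_subset isClosed_frontier
    frontier_subset_closure
  -- Prescribe `s` on `L`, and zero on the frontier of `V` and on `Z ∩ closure V`. The pieces `L`
  -- and `Z` may meet, but only where the germ of `s` is zero, so this is a section over the compact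
  -- union.
  obtain ⟨a, ha⟩ := exists_extension_of_globalGerm hF ((hL.union hfr).union (hVc.inter_left hZ))
    (fun x => if x ∈ L then globalGerm F x s else 0) (by
      intro x _
      by_cases hxL : x ∈ L
      · by_cases hxs : globalGerm F x s = 0
        · refine ⟨zeroLocus s, mem_zeroLocus.2 hxs, 0, fun y _ hy => ?_⟩
          simp [mem_zeroLocus.1 hy]
        · refine ⟨⟨(frontier V ∪ Z)ᶜ, (isClosed_frontier.union hZ).isOpen_compl⟩, ?_, s,
            fun y hyC hy => ?_⟩
          · rintro (h | h)
            · exact (hV.frontier_eq ▸ h).2 (hLV hxL)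
            · exact hxs (hs x h)
          · have hyL : y ∈ L := by
              rcases hyC with (h | h) | h
              · exact h
              · exact absurd (Or.inl h) hy
              · exact absurd (Or.inr h.1) hy
            simp [hyL]
      · refine ⟨⟨Lᶜ, hL.isClosed.isOpen_compl⟩, hxL, 0, fun y _ hy => ?_⟩
        have hyL : y ∉ L := hy
        simp [hyL])
  have haL : ∀ x ∈ L, globalGerm F x a = globalGerm F x s := fun x hx => by
    rw [ha x (Or.inl (Or.inl hx)), if_pos hx]
  have hafr : ∀ x ∈ frontier V, globalGerm F x a = 0 := fun x hx => by
    rw [ha x (Or.inl (Or.inr hx)), if_neg fun h => (hV.frontier_eq ▸ hx).2 (hLV h)]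
  have haZ : ∀ x ∈ Z, x ∈ V → globalGerm F x a = 0 := fun x hx hxV => by
    rw [ha x (Or.inr ⟨hx, subset_closure hxV⟩)]
    split_ifs
    · exact hs x hx
    · rfl
  -- The vanishing of a germ is an open condition, so `a` vanishes near the frontier of `V` and can
  -- be replaced by zero outside `V`.
  obtain ⟨r, hr⟩ := exists_globalGerm_eq (F := F)
    (fun x => if x ∈ V then globalGerm F x a else 0) (by
      intro x
      by_cases hxV : x ∈ V
      · exact ⟨⟨V, hV⟩, hxV, a, fun y hy => if_pos hy⟩
      · by_cases hxc : x ∈ closure V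
        · refine ⟨zeroLocus a, mem_zeroLocus.2 (hafr x ?_), 0, fun y hy => ?_⟩
          · rw [hV.frontier_eq]
            exact ⟨hxc, hxV⟩
          · simp [mem_zeroLocus.1 hy]
        · refine ⟨⟨(closure V)ᶜ, isClosed_closure.isOpen_compl⟩, hxc, 0, fun y hy => ?_⟩
          have hyV : y ∉ V := fun h => hy (subset_closure h)
          simp [hyV])
  have hrV : ∀ x, globalGerm F x r ≠ 0 → x ∈ V := fun x hx => by
    by_contra h
    exact hx (by rw [hr, if_neg h])
  refine ⟨r, hVc.of_isClosed_subset (isClosed_sectionSupport F r)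
    fun x hx => subset_closure (hrV x hx), fun x hx => ⟨hVU (subset_closure (hrV x hx)), fun hxZ =>
      hx ?_⟩, fun x hx => ?_⟩
  · rw [hr, if_pos (hrV x hx), haZ x hxZ (hrV x hx)]
  · rw [hr, if_pos (hLV hx), haL x hx]

end Sheaf

namespace EquivariantSheaf

/-- A compact set is a closed subset of its own sweep. The softness hypothesis is used only through
such sets. -/
theorem mem_generatedSupports_of_isCompact {G X : Type u} [Group G] [TopologicalSpace X]
    [MulAction G X] [T2Space X] {C : Set X} (hC : IsCompact C) :
    C ∈ generatedSupports (compactSweeps G X) := fun _ hΦ hΘ =>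
  hΦ.subset_mem _ (hΘ ⟨C, hC, rfl⟩) C hC.isClosed fun x hx => ⟨1, x, hx, one_smul G x⟩

end EquivariantSheaf

/-! ### Translates of sections and the norm. -/

namespace EquivariantSheaf

section Germ

variable {G : Type u} [Group G] {X : Type u} [TopologicalSpace X] [MulAction G X]
  (F : EquivariantSheaf G X)

/-- The germ of a global section at a point. -/
def germ (x : X) : F.sheaf.presheaf.obj (op ⊤) →+
    F.sheaf.presheaf.stalk (show TopCat.of X from x) :=
  globalGerm F.sheaf (show TopCat.of X from x)

/-- The action on global sections. -/
def globalAct (g : G) : F.sheaf.presheaf.obj (op ⊤) →+ F.sheaf.presheaf.obj (op ⊤) :=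
  F.act g (inv_smul_mem_top g)

variable {F}

theorem germ_ext {s t : F.sheaf.presheaf.obj (op ⊤)} (h : ∀ x, F.germ x s = F.germ x t) : s = t :=
  globalGerm_ext h

theorem globalAct_one (s : F.sheaf.presheaf.obj (op ⊤)) : F.globalAct 1 s = s := by
  refine (F.act_one (𝟙 ⊤) (inv_smul_mem_top _) s).trans ?_
  simp

theorem globalAct_mul (g h : G) (s : F.sheaf.presheaf.obj (op ⊤)) :
    F.globalAct (g * h) s = F.globalAct g (F.globalAct h s) :=
  F.act_mul g h (inv_smul_mem_top _) (inv_smul_mem_top _) (inv_smul_mem_top _) s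

theorem isClosed_setOf_germ_ne (s : F.sheaf.presheaf.obj (op ⊤)) :
    IsClosed {x : X | F.germ x s ≠ 0} := isClosed_sectionSupport F.sheaf s

variable [ContinuousConstSMul G X]

theorem germ_globalAct_eq_zero (g : G) (x : X) {s : F.sheaf.presheaf.obj (op ⊤)}
    (h : F.germ (g⁻¹ • x) s = 0) : F.germ x (F.globalAct g s) = 0 := by
  by_contra hx
  obtain ⟨y, hy, rfl⟩ := F.sectionSupport_act_subset g (inv_smul_mem_top g) s hx
  have hy' : F.germ y s ≠ 0 := hy
  refine hy' ?_
  have h2 : g⁻¹ • (g • y : X) = y := inv_smul_smul g _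
  rw [← h2]
  exact h

theorem germ_globalAct_congr (g : G) (x : X) {s t : F.sheaf.presheaf.obj (op ⊤)}
    (h : F.germ (g⁻¹ • x) s = F.germ (g⁻¹ • x) t) :
    F.germ x (F.globalAct g s) = F.germ x (F.globalAct g t) := by
  rw [← sub_eq_zero, ← map_sub] at h
  rw [← sub_eq_zero, ← map_sub, ← map_sub]
  exact germ_globalAct_eq_zero g x h

theorem coe_compactSectionsRho (g : G) (s : compactSections F.sheaf) :
    (F.compactSectionsRho g s).1 = F.globalAct g s.1 := rfl

end Germ

section Norm

variable {G : Type u} [CommGroup G] {X : Type u} [TopologicalSpace X] [MulAction G X]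
  [ContinuousConstSMul G X] [ProperlyDiscontinuousSMul G X] [LocallyCompactSpace X]
  {F : EquivariantSheaf G X}

/-- Local finiteness of the translates: only finitely many elements move the compact support of `s`
to meet a compact neighbourhood of `x`. -/
theorem exists_finset_germ_globalAct_eq_zero (s : compactSections F.sheaf) (x : X) :
    ∃ U : Set X, IsOpen U ∧ x ∈ U ∧ ∃ A : Finset G, ∀ y ∈ U, ∀ g ∉ A,
      F.germ y (F.globalAct g s.1) = 0 := by
  obtain ⟨K, hK, hxK⟩ := exists_compact_mem_nhds x
  have hfin := ProperlyDiscontinuousSMul.finite_disjoint_inter_image (Γ := G) (T := X)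
    (show IsCompact (sectionSupport F.sheaf s.1) from s.2) hK
  refine ⟨interior K, isOpen_interior, mem_interior_iff_mem_nhds.2 hxK, hfin.toFinset,
    fun y hy g hg => ?_⟩
  by_contra h
  refine hg (hfin.mem_toFinset.2 ⟨y, F.sectionSupport_act_subset g (inv_smul_mem_top g) s.1 h,
    interior_subset hy⟩)

theorem finite_germ_globalAct_ne_zero (H : Subgroup G) (s : compactSections F.sheaf) (x : X) :
    (Function.support fun h : H => F.germ x (F.globalAct h s.1)).Finite := by
  obtain ⟨U, -, hxU, A, hA⟩ := exists_finset_germ_globalAct_eq_zero s x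
  refine (A.finite_toSet.preimage (Subtype.val_injective.injOn)).subset fun h hh => ?_
  by_contra h'
  exact hh (hA x hxU h h')

open Classical in
theorem exists_norm (H : Subgroup G) (s : compactSections F.sheaf) :
    ∃ t : F.sheaf.presheaf.obj (op ⊤), ∀ x : X,
      F.germ x t = ∑ᶠ h : H, F.germ x (F.globalAct h s.1) := by
  refine exists_globalGerm_eq (F := F.sheaf)
    (fun x => ∑ᶠ h : H, F.germ x (F.globalAct h s.1)) fun x => ?_
  obtain ⟨U, hU, hxU, A, hA⟩ := exists_finset_germ_globalAct_eq_zero s x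
  refine ⟨⟨U, hU⟩, hxU, ∑ h ∈ A.subtype (· ∈ H), F.globalAct h s.1, fun y hy => ?_⟩
  rw [map_sum]
  refine finsum_eq_sum_of_support_subset _ fun h hh => ?_
  by_contra h'
  exact hh (hA y hy h (by simpa using h'))

/-- The sum of the translates of a compactly supported section by the elements of a subgroup. -/
def norm (H : Subgroup G) : compactSections F.sheaf →+ F.sheaf.presheaf.obj (op ⊤) :=
  AddMonoidHom.mk' (fun s => (exists_norm H s).choose) fun s t => germ_ext fun x => by
    rw [map_add, (exists_norm H (s + t)).choose_spec, (exists_norm H s).choose_spec,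
      (exists_norm H t).choose_spec, ← finsum_add_distrib (finite_germ_globalAct_ne_zero H s x)
        (finite_germ_globalAct_ne_zero H t x)]
    exact finsum_congr fun h => by rw [← map_add, ← map_add]; rfl

theorem germ_norm (H : Subgroup G) (s : compactSections F.sheaf) (x : X) :
    F.germ x (norm H s) = ∑ᶠ h : H, F.germ x (F.globalAct h s.1) :=
  (exists_norm H s).choose_spec x

theorem norm_compactSectionsRho_of_mem (H : Subgroup G) {g : G} (hg : g ∈ H)
    (s : compactSections F.sheaf) : norm H (F.compactSectionsRho g s) = norm H s := by
  refine germ_ext fun x => ?_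
  rw [germ_norm, germ_norm]
  refine finsum_eq_of_bijective (Equiv.mulRight (⟨g, hg⟩ : H)) (Equiv.bijective _) fun h => ?_
  rw [coe_compactSectionsRho, ← globalAct_mul]
  rfl

/-- Near `g⁻¹ • x` the norm agrees with a finite sum, which `g` acts on termwise; commutativity
moves `g` past `h`. -/
theorem globalAct_norm (H : Subgroup G) (g : G) (s : compactSections F.sheaf) :
    F.globalAct g (norm H s) = norm H (F.compactSectionsRho g s) := by
  refine germ_ext fun x => ?_
  have hfin := finite_germ_globalAct_ne_zero H s (g⁻¹ • x)
  have h1 : F.germ (g⁻¹ • x) (norm H s) =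
      F.germ (g⁻¹ • x) (∑ h ∈ hfin.toFinset, F.globalAct h s.1) := by
    rw [germ_norm, finsum_eq_sum _ hfin, map_sum]
  rw [germ_globalAct_congr g x h1, germ_norm, map_sum, map_sum]
  symm
  refine (finsum_congr fun h => ?_).trans (finsum_eq_sum_of_support_subset
    (fun h : H => F.germ x (F.globalAct g (F.globalAct h s.1))) fun h hh => ?_)
  · rw [coe_compactSectionsRho, ← globalAct_mul, ← globalAct_mul, mul_comm]
  · refine hfin.mem_toFinset.2 fun h0 => hh ?_
    exact germ_globalAct_eq_zero g x h0

theorem globalAct_norm_of_mem (H : Subgroup G) {g : G} (hg : g ∈ H) (s : compactSections F.sheaf) :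
    F.globalAct g (norm H s) = norm H s := by
  rw [globalAct_norm, norm_compactSectionsRho_of_mem H hg]

theorem exists_germ_ne_zero_of_norm (H : Subgroup G) (s : compactSections F.sheaf) {x : X}
    (hx : F.germ x (norm H s) ≠ 0) : ∃ h ∈ H, F.germ (h • x) s.1 ≠ 0 := by
  rw [germ_norm] at hx
  obtain ⟨h, hh⟩ : ∃ h : H, F.germ x (F.globalAct h s.1) ≠ 0 := by
    by_contra! h0
    exact hx (finsum_eq_zero_of_forall_eq_zero h0)
  exact ⟨h⁻¹, H.inv_mem h.2, fun h0 => hh (germ_globalAct_eq_zero _ x h0)⟩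

theorem norm_eq_zero_of_mem_ker (H : Subgroup G) {s : compactSections F.sheaf}
    (hs : s ∈ Representation.Coinvariants.ker (F.compactSectionsRho.comp H.subtype)) :
    norm H s = 0 := by
  refine Submodule.span_induction ?_ (map_zero _) (fun a b _ _ ha hb => ?_)
    (fun n a _ ha => ?_) hs
  · rintro _ ⟨⟨h, v⟩, rfl⟩
    rw [map_sub, sub_eq_zero]
    exact norm_compactSectionsRho_of_mem H h.2 v
  · rw [map_add, ha, hb, add_zero]
  · change norm H (n.down • a) = 0
    rw [map_zsmul, ha, smul_zero]

/-- If `t` has infinite order modulo `H`, then `t - 1` is injective on the image of the norm. -/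
theorem norm_eq_zero_of_sub_mem_ker (H : Subgroup G) {t : G} (ht : ∀ n : ℤ, t ^ n ∈ H → n = 0)
    (s : compactSections F.sheaf) (hs : F.compactSectionsRho t s - s ∈
      Representation.Coinvariants.ker (F.compactSectionsRho.comp H.subtype)) :
    norm H s = 0 := by
  have h1 : F.globalAct t (norm H s) = norm H s := by
    rw [globalAct_norm, ← sub_eq_zero, ← map_sub]
    exact norm_eq_zero_of_mem_ker H hs
  let K : Subgroup G :=
    { carrier := {g | F.globalAct g (norm H s) = norm H s}
      one_mem' := globalAct_one _
      mul_mem' := fun {a b} ha hb => by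
        change F.globalAct _ _ = _
        rw [globalAct_mul, hb, ha]
      inv_mem' := fun {a} ha => by
        change F.globalAct _ _ = _
        have ha : F.globalAct a _ = _ := ha
        conv_lhs => rw [← ha, ← globalAct_mul, inv_mul_cancel, globalAct_one] }
  have hK : ∀ n : ℤ, F.globalAct (t ^ n) (norm H s) = norm H s := fun n =>
    K.zpow_mem (show t ∈ K from h1) n
  refine germ_ext fun x => ?_
  rw [map_zero]
  by_contra hx
  -- The norm is fixed by all `tⁿ`, so its germ is nonzero along the whole orbit of `x` under `t`;
  -- hence some `h n ∈ H` brings `tⁿ • x` into the support of `s`.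
  have h2 : ∀ n : ℤ, ∃ h ∈ H, F.germ (h • t ^ n • x) s.1 ≠ 0 := fun n => by
    refine exists_germ_ne_zero_of_norm H s fun h0 => hx ?_
    rw [← hK (-n)]
    refine germ_globalAct_eq_zero _ x ?_
    rwa [← zpow_neg, neg_neg]
  choose h hH hne using h2
  have hfin := ProperlyDiscontinuousSMul.finite_disjoint_inter_image (Γ := G) (T := X) (isCompact_singleton (x := x))
    (show IsCompact (sectionSupport F.sheaf s.1) from s.2)
  -- The elements `h n * tⁿ` lie in different cosets of `H`, so infinitely many elements bring `x`
  -- into a compact set, against properness.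
  have hinj : Function.Injective fun n : ℤ => h n * t ^ n := by
    intro m n hmn
    have h3 : t ^ (m - n) = (h m)⁻¹ * h n := by
      have hmn : h m * t ^ m = h n * t ^ n := hmn
      rw [zpow_sub, mul_inv_eq_iff_eq_mul, mul_assoc, ← hmn, inv_mul_cancel_left]
    exact sub_eq_zero.1 (ht _ (h3 ▸ H.mul_mem (H.inv_mem (hH m)) (hH n)))
  refine Set.infinite_univ (α := ℤ) (Set.Finite.of_finite_image (f := fun n : ℤ => h n * t ^ n)
    (hfin.subset ?_) hinj.injOn)
  rintro _ ⟨n, -, rfl⟩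
  refine ⟨_, ⟨x, rfl, rfl⟩, ?_⟩
  simp only [mul_smul]
  exact hne n

end Norm

end EquivariantSheaf

/-- A compact set is wandering if it has an open neighbourhood whose translates are disjoint. -/
structure IsWanderingCompact (G : Type u) {X : Type u} [Group G] [TopologicalSpace X]
    [MulAction G X] (L : Set X) : Prop where
  isCompact : IsCompact L
  exists_isOpen : ∃ U : Set X, IsOpen U ∧ L ⊆ U ∧ ∀ g : G, ∀ x ∈ U, g • x ∈ U → g = 1

/-! ### Covers by wandering compact sets. -/

section Covering

variable {G : Type u} [Group G] {X : Type u} [TopologicalSpace X] [MulAction G X]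
  [ContinuousConstSMul G X] [ProperlyDiscontinuousSMul G X] [LocallyCompactSpace X] [T2Space X]

theorem isClosed_setOf_exists_smul_mem (H : Subgroup G) {L : Set X} (hL : IsCompact L) :
    IsClosed {x : X | ∃ h ∈ H, h • x ∈ L} := by
  have h : {x : X | ∃ h ∈ H, h • x ∈ L} = ⋃ h : H, (fun x : X => (h : G) • x) ⁻¹' L := by
    ext x
    simp
  rw [h]
  refine LocallyFinite.isClosed_iUnion (fun x => ?_) fun h =>
    hL.isClosed.preimage (continuous_const_smul (h : G))
  obtain ⟨K, hK, hxK⟩ := exists_compact_mem_nhds x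
  refine ⟨K, hxK, ((ProperlyDiscontinuousSMul.finite_disjoint_inter_image (Γ := G) hK hL).preimage
    Subtype.val_injective.injOn).subset ?_⟩
  rintro h ⟨y, hy, hyK⟩
  exact ⟨_, ⟨y, hyK, rfl⟩, hy⟩

theorem exists_isWanderingCompact_mem_nhds (hfree : ∀ (g : G) (x : X), g • x = x → g = 1) (x : X) :
    ∃ L ∈ nhds x, IsWanderingCompact G L := by
  obtain ⟨U, hU, hUx⟩ := ProperlyDiscontinuousSMul.exists_nhds_image_smul_eq_self G x
  obtain ⟨L, hL, hLU, hLc⟩ := local_compact_nhds (interior_mem_nhds.2 hU)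
  exact ⟨L, hL, hLc, interior U, isOpen_interior, hLU, fun g y hy hgy =>
    hfree g x (hUx g ⟨_, ⟨y, interior_subset hy, rfl⟩, interior_subset hgy⟩)⟩

/-- Shaped for induction on `t`: `Z` is the closed invariant set where a section is already known to
vanish, and each step adds the sweep of one `L i` to it. Initially `Z` is the complement of the
sweeps of the interiors of the `L i`. The family `L` is indexed by all of `X` so that it stays fixed
while `t` shrinks. -/
theorem exists_wandering_cover (hfree : ∀ (g : G) (x : X), g • x = x → g = 1) (H : Subgroup G)
    {K : Set X} (hK : IsCompact K) :
    ∃ L : X → Set X, (∀ x, IsWanderingCompact G (L x)) ∧ ∃ (t : Finset X) (Z : Set X),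
      IsClosed Z ∧ (∀ h ∈ H, ∀ x ∈ Z, h • x ∈ Z) ∧ (∀ x ∈ Z, ∀ h ∈ H, h • x ∉ K) ∧
      ∀ x, x ∈ Z ∨ ∃ i ∈ t, ∃ h ∈ H, h • x ∈ L i := by
  choose L hL hLw using fun x : X => exists_isWanderingCompact_mem_nhds (G := G) hfree x
  obtain ⟨t, -, ht⟩ := hK.elim_nhds_subcover (fun x => interior (L x))
    fun x _ => interior_mem_nhds.2 (hL x)
  refine ⟨L, hLw, t, {x | ∀ h ∈ H, ∀ i ∈ t, h • x ∉ interior (L i)}, ?_, ?_, ?_, ?_⟩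
  · simp only [Set.ofPred_forall]
    exact isClosed_iInter fun h => isClosed_iInter fun _ => isClosed_iInter fun i =>
      isClosed_iInter fun _ => (isOpen_interior.preimage (continuous_const_smul h)).isClosed_compl
  · intro g hg x hx h hh i hi
    rw [← mul_smul]
    exact hx _ (H.mul_mem hh hg) i hi
  · intro x hx h hh hK
    obtain ⟨i, hi, hxi⟩ := Set.mem_iUnion₂.1 (ht hK)
    exact hx h hh i hi hxi
  · intro x
    by_cases hx : ∀ h ∈ H, ∀ i ∈ t, h • x ∉ interior (L i)
    · exact Or.inl hx
    · push Not at hx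
      obtain ⟨h, hh, i, hi, hxi⟩ := hx
      exact Or.inr ⟨i, hi, h, hh, interior_subset hxi⟩

end Covering

/-! ### Kernel and image of the norm. -/

namespace EquivariantSheaf

section Cutoff

variable {G : Type u} [Group G] {X : Type u} [TopologicalSpace X] [MulAction G X]
  [LocallyCompactSpace X] [T2Space X] {F : EquivariantSheaf G X}

theorem exists_compactSections_cutoff (hF : IsSoft (generatedSupports (compactSweeps G X)) F.sheaf)
    (s : F.sheaf.presheaf.obj (op ⊤)) {Z : Set X} (hZ : IsClosed Z) (hs : ∀ x ∈ Z, F.germ x s = 0)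
    {L U : Set X} (hL : IsCompact L) (hU : IsOpen U) (hLU : L ⊆ U) :
    ∃ r : compactSections F.sheaf, (∀ x, F.germ x r.1 ≠ 0 → x ∈ U ∧ x ∉ Z) ∧
      ∀ x ∈ L, F.germ x r.1 = F.germ x s := by
  have : T2Space (TopCat.of X) := inferInstanceAs (T2Space X)
  have : LocallyCompactSpace (TopCat.of X) := inferInstanceAs (LocallyCompactSpace X)
  obtain ⟨r, hr, h1, h2⟩ := exists_cutoff (F := F.sheaf)
    (fun C hC => hF C (mem_generatedSupports_of_isCompact hC)) s hZ hs hL hU hLU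
  exact ⟨⟨r, hr⟩, h1, h2⟩

end Cutoff

variable {G : Type u} [CommGroup G] {X : Type u} [TopologicalSpace X] [MulAction G X]
  [ContinuousConstSMul G X] [ProperlyDiscontinuousSMul G X] [LocallyCompactSpace X] [T2Space X]
  {F : EquivariantSheaf G X}

/-- A section of norm zero is congruent, modulo the relations of the coinvariants, to a section
that vanishes on the translates of a given wandering compact set. -/
theorem exists_sub_mem_ker_of_norm_eq_zero
    (hF : IsSoft (generatedSupports (compactSweeps G X)) F.sheaf) (H : Subgroup G)
    {L : Set X} (hL : IsWanderingCompact G L) {Z : Set X} (hZ : IsClosed Z)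
    (hHZ : ∀ h ∈ H, ∀ x ∈ Z, h • x ∈ Z) (s : compactSections F.sheaf)
    (hs : ∀ x ∈ Z, F.germ x s.1 = 0) (hn : norm H s = 0) :
    ∃ r : compactSections F.sheaf,
      s - r ∈ Representation.Coinvariants.ker (F.compactSectionsRho.comp H.subtype) ∧
      (∀ x ∈ Z, F.germ x r.1 = 0) ∧ ∀ x, (∃ h ∈ H, h • x ∈ L) → F.germ x r.1 = 0 := by
  obtain ⟨hLc, U, hU, hLU, hUw⟩ := hL
  -- `f h` is a cutoff of `s` near `h⁻¹ L`, supported in `h⁻¹ U`. The last clause forces `f h = 0`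
  -- when `s` vanishes on `h⁻¹ L`, which makes all but finitely many `f h` zero.
  have hex : ∀ h : H, ∃ f : compactSections F.sheaf,
      (∀ x, F.germ x f.1 ≠ 0 → (h : G) • x ∈ U ∧ x ∉ Z) ∧
      (∀ x, (h : G) • x ∈ L → F.germ x f.1 = F.germ x s.1) ∧
      ((∀ x, (h : G) • x ∈ L → F.germ x s.1 = 0) → f = 0) := by
    intro h
    by_cases h0 : ∀ x, (h : G) • x ∈ L → F.germ x s.1 = 0
    · exact ⟨0, fun x hx => absurd (map_zero _) hx, fun x hx => (h0 x hx).symm ▸ map_zero _,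
        fun _ => rfl⟩
    · obtain ⟨f, hf1, hf2⟩ := exists_compactSections_cutoff hF s.1 hZ hs
        ((Homeomorph.smul (h : G)).isClosedEmbedding.isCompact_preimage hLc)
        (hU.preimage (continuous_const_smul (h : G))) (Set.preimage_mono hLU)
      exact ⟨f, hf1, hf2, fun h1 => absurd h1 h0⟩
  choose f hfU hfL hf0 using hex
  have hfin : {h : H | f h ≠ 0}.Finite := by
    refine ((ProperlyDiscontinuousSMul.finite_disjoint_inter_image (Γ := G) (T := X)
      (show IsCompact (sectionSupport F.sheaf s.1) from s.2) hLc).preimage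
      Subtype.val_injective.injOn).subset fun h hh => ?_
    by_contra h1
    refine hh (hf0 h fun x hx => ?_)
    by_contra h2
    exact h1 ⟨_, ⟨x, h2, rfl⟩, hx⟩
  have hmem : ∀ h, h ∉ hfin.toFinset → f h = 0 := fun h hh => by
    by_contra h1
    exact hh (hfin.mem_toFinset.2 h1)
  have hact : ∀ (h : H) (x : X), F.germ x (F.globalAct h (f h).1) ≠ 0 → x ∈ U ∧ x ∉ Z := by
    intro h x hx
    have h1 := hfU h ((h : G)⁻¹ • x) fun h0 => hx (germ_globalAct_eq_zero _ _ h0)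
    rw [smul_inv_smul] at h1
    exact ⟨h1.1, fun hxZ => h1.2 (hHZ _ (H.inv_mem h.2) x hxZ)⟩
  have hgerm : ∀ x, F.germ x
      (s - ∑ h ∈ hfin.toFinset, (f h - F.compactSectionsRho h (f h)) :
        compactSections F.sheaf).1 = F.germ x s.1 - (∑ h ∈ hfin.toFinset, F.germ x (f h).1 -
          ∑ h ∈ hfin.toFinset, F.germ x (F.globalAct h (f h).1)) := by
    intro x
    rw [AddSubgroup.coe_sub, map_sub, AddSubgroup.val_finsetSum, map_sum,
      ← Finset.sum_sub_distrib]
    congr 1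
    refine Finset.sum_congr rfl fun h _ => ?_
    rw [AddSubgroup.coe_sub, map_sub, coe_compactSectionsRho]
  -- Each piece of `s` near `h⁻¹ L` is moved to `L`, where the pieces add up to the norm of `s` and
  -- so cancel.
  refine ⟨s - ∑ h ∈ hfin.toFinset, (f h - F.compactSectionsRho h (f h)), ?_, fun x hx => ?_,
    fun x => ?_⟩
  · rw [sub_sub_cancel]
    refine Submodule.sum_mem _ fun h _ => ?_
    rw [← neg_sub]
    exact Submodule.neg_mem _ (Representation.Coinvariants.sub_mem_ker
      (ρ := F.compactSectionsRho.comp H.subtype) h (f h))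
  · rw [hgerm, hs x hx, Finset.sum_eq_zero, Finset.sum_eq_zero, sub_self, sub_self]
    · intro h _
      by_contra h0
      exact (hact h x h0).2 hx
    · intro h _
      by_contra h0
      exact (hfU h x h0).2 hx
  · rintro ⟨g, hg, hx⟩
    -- The sets `h⁻¹ U` are disjoint, so at a point of `g⁻¹ L` only `f g` contributes.
    have h1 : ∑ h ∈ hfin.toFinset, F.germ x (f h).1 = F.germ x s.1 := by
      rw [Finset.sum_eq_single ⟨g, hg⟩, hfL _ x hx]
      · intro h _ hne
        by_contra h0
        refine hne (Subtype.ext ?_)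
        have h2 := hUw (h * g⁻¹) (g • x) (hLU hx) (by
          rw [mul_smul, inv_smul_smul]
          exact (hfU h x h0).1)
        exact mul_inv_eq_one.1 h2
      · intro h
        rw [hmem _ h]
        exact map_zero _
    -- All translated pieces live in `U`. A point of `U` in the sweep of `L` lies in `L` itself, and
    -- there the sum is the germ of `norm H s = 0`.
    have h2 : ∑ h ∈ hfin.toFinset, F.germ x (F.globalAct h (f h).1) = 0 := by
      by_cases hxU : x ∈ U
      · have hxL : x ∈ L := by
          rwa [hUw g x hxU (hLU hx), one_smul] at hx
        have h3 : ∀ h : H, F.germ x (F.globalAct h (f h).1) = F.germ x (F.globalAct h s.1) :=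
          fun h => germ_globalAct_congr _ _ (hfL h _ (by rwa [smul_inv_smul]))
        rw [← map_zero (F.germ x), ← hn, germ_norm, Finset.sum_congr rfl fun h _ => h3 h]
        symm
        refine finsum_eq_sum_of_support_subset _ fun h hh => ?_
        by_contra h4
        refine hh ((h3 h).symm.trans ?_)
        rw [hmem h h4, ZeroMemClass.coe_zero, map_zero, map_zero]
      · refine Finset.sum_eq_zero fun h _ => ?_
        by_contra h0
        exact hxU (hact h x h0).1
    rw [hgerm, h1, h2, sub_zero, sub_self]

/-- The kernel of the norm consists of the relations of the coinvariants. -/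
theorem mem_ker_of_norm_eq_zero (hfree : ∀ (g : G) (x : X), g • x = x → g = 1)
    (hF : IsSoft (generatedSupports (compactSweeps G X)) F.sheaf) (H : Subgroup G)
    (s : compactSections F.sheaf) (hn : norm H s = 0) :
    s ∈ Representation.Coinvariants.ker (F.compactSectionsRho.comp H.subtype) := by
  classical
  obtain ⟨L, hL, t, Z, hZ, hHZ, hZK, hcov⟩ := exists_wandering_cover (G := G) hfree H
    (show IsCompact (sectionSupport F.sheaf s.1) from s.2)
  have hs : ∀ x ∈ Z, F.germ x s.1 = 0 := fun x hx => by
    by_contra h0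
    refine hZK x hx 1 H.one_mem ?_
    rw [one_smul]
    exact h0
  clear hZK
  -- Subtracting relations preserves norm zero, so the sweeps can be cleared one after another until
  -- the section vanishes everywhere.
  induction t using Finset.induction_on generalizing Z s with
  | empty =>
    have h0 : s = 0 := Subtype.ext (germ_ext fun x => by
      rw [hs x ((hcov x).resolve_right (by simp)), ZeroMemClass.coe_zero, map_zero])
    rw [h0]
    exact Submodule.zero_mem _
  | insert a t _ ih =>
    obtain ⟨r, hsr, hrZ, hrL⟩ :=
      exists_sub_mem_ker_of_norm_eq_zero hF H (hL a) hZ hHZ s hs hn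
    have hr : norm H r = 0 := by
      rw [← sub_sub_cancel s r, map_sub, hn, norm_eq_zero_of_mem_ker H hsr, sub_zero]
    have h1 := ih r hr (Z ∪ {x | ∃ h ∈ H, h • x ∈ L a})
      (hZ.union (isClosed_setOf_exists_smul_mem H (hL a).isCompact)) (by
        rintro h hh x (hx | ⟨g, hg, hx⟩)
        · exact Or.inl (hHZ h hh x hx)
        · exact Or.inr ⟨g * h⁻¹, H.mul_mem hg (H.inv_mem hh), by rwa [mul_smul, inv_smul_smul]⟩)
      (by
        intro x
        rcases hcov x with hx | ⟨i, hi, hx⟩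
        · exact Or.inl (Or.inl hx)
        · rcases Finset.mem_insert.1 hi with rfl | hi
          · exact Or.inl (Or.inr hx)
          · exact Or.inr ⟨i, hi, hx⟩)
      (by
        rintro x (hx | hx)
        · exact hrZ x hx
        · exact hrL x hx)
    rw [← sub_add_cancel s r]
    exact Submodule.add_mem _ hsr h1

/-- Every invariant section whose support is contained in the sweep of a compact set is a norm. -/
theorem exists_norm_eq (hfree : ∀ (g : G) (x : X), g • x = x → g = 1)
    (hF : IsSoft (generatedSupports (compactSweeps G X)) F.sheaf) (H : Subgroup G)
    (T : F.sheaf.presheaf.obj (op ⊤)) (hT : ∀ h ∈ H, F.globalAct h T = T) {K : Set X}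
    (hK : IsCompact K) (hTK : ∀ x, F.germ x T ≠ 0 → ∃ h ∈ H, h • x ∈ K) :
    ∃ s : compactSections F.sheaf, norm H s = T := by
  classical
  obtain ⟨L, hL, t, Z, hZ, hHZ, hZK, hcov⟩ := exists_wandering_cover (G := G) hfree H hK
  have hs : ∀ x ∈ Z, F.germ x T = 0 := fun x hx => by
    by_contra h0
    obtain ⟨h, hh, hx'⟩ := hTK x h0
    exact hZK x hx h hh hx'
  clear hZK hTK
  induction t using Finset.induction_on generalizing Z T with
  | empty =>
    refine ⟨0, germ_ext fun x => ?_⟩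
    rw [hs x ((hcov x).resolve_right (by simp)), map_zero, map_zero]
  | insert a t _ ih =>
    obtain ⟨hLc, U, hU, hLU, hUw⟩ := hL a
    -- The norm of this cutoff agrees with `T` on the sweep of `L a` and still vanishes on `Z`, so
    -- `T - norm H s` vanishes on the enlarged closed set.
    obtain ⟨s, hsU, hsL⟩ := exists_compactSections_cutoff hF T hZ hs hLc hU hLU
    obtain ⟨r, hr⟩ := ih (T - norm H s)
      (fun h hh => by rw [map_sub, hT h hh, globalAct_norm_of_mem H hh])
      (Z ∪ {x | ∃ h ∈ H, h • x ∈ L a})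
      (hZ.union (isClosed_setOf_exists_smul_mem H hLc)) (by
        rintro h hh x (hx | ⟨g, hg, hx⟩)
        · exact Or.inl (hHZ h hh x hx)
        · exact Or.inr ⟨g * h⁻¹, H.mul_mem hg (H.inv_mem hh), by rwa [mul_smul, inv_smul_smul]⟩)
      (by
        intro x
        rcases hcov x with hx | ⟨i, hi, hx⟩
        · exact Or.inl (Or.inl hx)
        · rcases Finset.mem_insert.1 hi with rfl | hi
          · exact Or.inl (Or.inr hx)
          · exact Or.inr ⟨i, hi, hx⟩)
      (by
        rintro x (hx | ⟨g, hg, hx⟩)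
        · rw [map_sub, hs x hx, zero_sub, neg_eq_zero]
          by_contra h0
          obtain ⟨h, hh, h1⟩ := exists_germ_ne_zero_of_norm H s h0
          exact (hsU _ h1).2 (hHZ h hh x hx)
        -- With `g • x ∈ L a`, a term `h` contributes at `x` only if `h⁻¹ • x ∈ U`; disjointness of
        -- the translates of `U` leaves `h = g⁻¹`.
        · rw [map_sub, sub_eq_zero, germ_norm, finsum_eq_single _ (⟨g⁻¹, H.inv_mem hg⟩ : H)]
          · rw [germ_globalAct_congr g⁻¹ x (t := T), hT _ (H.inv_mem hg)]
            rw [inv_inv]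
            exact hsL _ hx
          · intro h hne
            by_contra h0
            refine hne (Subtype.ext ?_)
            have h1 := hsU ((h : G)⁻¹ • x) fun h2 => h0 (germ_globalAct_eq_zero _ x h2)
            have h2 := hUw ((h : G)⁻¹ * g⁻¹) (g • x) (hLU hx) (by
              rw [mul_smul, inv_smul_smul]
              exact h1.1)
            exact inv_eq_iff_eq_inv.1 (mul_inv_eq_one.1 h2))
    exact ⟨r + s, by rw [map_add, hr, sub_add_cancel]⟩

end EquivariantSheaf

/-! ### Compact supports on the orbit space. -/

namespace EquivariantSheaf

section Invariants

variable {G : Type u} [Group G] {X : Type u} [TopologicalSpace X] [MulAction G X]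
  (F : EquivariantSheaf G X)

/-- A global section of the sheaf of invariants, as a global section of the equivariant sheaf. -/
def ofInvariants : F.invariants.presheaf.obj (op ⊤) →+ F.sheaf.presheaf.obj (op ⊤) :=
  (F.invariantSections ⊤).subtype

theorem ofInvariants_injective : Function.Injective F.ofInvariants :=
  Subtype.val_injective

theorem globalAct_ofInvariants (s : F.invariants.presheaf.obj (op ⊤)) (g : G) :
    F.globalAct g (F.ofInvariants s) = F.ofInvariants s :=
  s.2 g

variable [ContinuousConstSMul G X]

theorem mem_sectionSupport_invariants (s : F.invariants.presheaf.obj (op ⊤)) (x : X) :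
    (Quotient.mk (MulAction.orbitRel G X) x :
      TopCat.of (MulAction.orbitRel.Quotient G X)) ∈ sectionSupport F.invariants s ↔
      F.germ x (F.ofInvariants s) ≠ 0 := by
  refine not_congr ⟨fun h => ?_, fun h => ?_⟩
  · obtain ⟨W, hxW, i, _, hW⟩ := F.invariants.presheaf.germ_eq _ (Opens.mem_top _)
      (Opens.mem_top _) s 0 (h.trans (map_zero _).symm)
    rw [map_zero] at hW
    have hW' : F.sheaf.presheaf.map (orbitPreimageHom i).op (F.ofInvariants s) = 0 :=
      congrArg Subtype.val hW
    refine (F.sheaf.presheaf.germ_res_apply (orbitPreimageHom i)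
      (show TopCat.of X from x) hxW (F.ofInvariants s)).symm.trans ?_
    rw [hW', map_zero]
  -- The zero set of an invariant section is open and invariant, so its image `W` is open and the
  -- section vanishes on all of the preimage of `W`.
  · let W : Opens (MulAction.orbitRel.Quotient G X) :=
      ⟨Quotient.mk _ '' {y : X | F.germ y (F.ofInvariants s) = 0},
        MulAction.isOpenQuotientMap_quotientMk.isOpenMap _
          (by simpa [Set.compl_ofPred] using
            (isClosed_setOf_germ_ne (F.ofInvariants s)).isOpen_compl)⟩
    have hW : F.invariants.presheaf.map (homOfLE (le_top : W ≤ ⊤)).op s = 0 := by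
      refine Subtype.ext (TopCat.Presheaf.section_ext F.sheaf _ _ _ fun y hy => ?_)
      refine (F.sheaf.presheaf.germ_res_apply (orbitPreimageHom (homOfLE (le_top : W ≤ ⊤)))
        y hy (F.ofInvariants s)).trans ?_
      obtain ⟨z, hz, hzy⟩ := hy
      obtain ⟨g, hg⟩ := Quotient.exact hzy
      have hg : g • (show X from y) = z := hg
      refine Eq.trans ?_ (map_zero _).symm
      change F.germ y (F.ofInvariants s) = 0
      rw [← F.globalAct_ofInvariants s g⁻¹]
      refine germ_globalAct_eq_zero _ _ ?_
      rw [inv_inv, hg]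
      exact hz
    refine (F.invariants.presheaf.germ_res_apply (homOfLE (le_top : W ≤ ⊤)) _
      ⟨x, h, rfl⟩ s).symm.trans ?_
    rw [hW, map_zero]

variable [LocallyCompactSpace X]

/-- The quotient map is open and `X` is locally compact, so a compact subset of the orbit space is
covered by the image of a compact subset of `X`. -/
theorem mem_compactSections_invariants_iff (s : F.invariants.presheaf.obj (op ⊤)) :
    s ∈ compactSections F.invariants ↔ ∃ K : Set X, IsCompact K ∧
      ∀ x, F.germ x (F.ofInvariants s) ≠ 0 → ∃ g : G, g • x ∈ K := by
  have hq := MulAction.isOpenQuotientMap_quotientMk (Γ := G) (T := X)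
  constructor
  · intro hs
    have hs : IsCompact (sectionSupport F.invariants s) := hs
    choose L hL hxL using fun x : X => exists_compact_mem_nhds x
    obtain ⟨t, ht⟩ := hs.elim_finite_subcover
      (fun x : X => (Quotient.mk (MulAction.orbitRel G X) '' interior (L x) :
        Set (MulAction.orbitRel.Quotient G X)))
      (fun x => hq.isOpenMap _ isOpen_interior) (fun y _ => by
        obtain ⟨x, rfl⟩ := hq.surjective y
        exact Set.mem_iUnion.2 ⟨x, x, mem_interior_iff_mem_nhds.2 (hxL x), rfl⟩)
    refine ⟨⋃ x ∈ t, L x, t.isCompact_biUnion fun x _ => hL x, fun x hx => ?_⟩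
    obtain ⟨i, hi, z, hz, hzx⟩ := Set.mem_iUnion₂.1 (ht ((F.mem_sectionSupport_invariants s x).2 hx))
    obtain ⟨g, hg⟩ := Quotient.exact hzx
    have hg : g • x = z := hg
    exact ⟨g, Set.mem_iUnion₂.2 ⟨i, hi, hg ▸ interior_subset hz⟩⟩
  · rintro ⟨K, hK, h⟩
    refine (hK.image hq.continuous).of_isClosed_subset (isClosed_sectionSupport F.invariants s)
      fun y hy => ?_
    obtain ⟨x, rfl⟩ := hq.surjective y
    obtain ⟨g, hg⟩ := h x ((F.mem_sectionSupport_invariants s x).1 hy)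
    exact ⟨_, hg, Quotient.sound ⟨g, rfl⟩⟩

end Invariants

section Coinvariants

variable {G : Type u} [CommGroup G] {X : Type u} [TopologicalSpace X] [MulAction G X]
  [ContinuousConstSMul G X] [ProperlyDiscontinuousSMul G X] [LocallyCompactSpace X]
  (F : EquivariantSheaf G X)

/-- The norm, as a homomorphism to the compactly supported sections on the orbit space. -/
def normInvariants : compactSections F.sheaf →+ compactSections F.invariants where
  toFun s := ⟨⟨norm ⊤ s, fun g => globalAct_norm_of_mem ⊤ (Subgroup.mem_top g) s⟩,
    (F.mem_compactSections_invariants_iff _).2 ⟨_, s.2, fun _ hx =>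
      let ⟨h, _, hh⟩ := exists_germ_ne_zero_of_norm ⊤ s hx
      ⟨h, hh⟩⟩⟩
  map_zero' := Subtype.ext (Subtype.ext (map_zero _))
  map_add' s t := Subtype.ext (Subtype.ext (map_add _ s t))

theorem normInvariants_eq_zero_iff {s : compactSections F.sheaf} :
    F.normInvariants s = 0 ↔ norm ⊤ s = 0 :=
  ⟨fun h => congrArg (fun t => F.ofInvariants t.1) h, fun h => Subtype.ext (Subtype.ext h)⟩

variable [T2Space X]

theorem normInvariants_surjective (hfree : ∀ (g : G) (x : X), g • x = x → g = 1)
    (hF : IsSoft (generatedSupports (compactSweeps G X)) F.sheaf) :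
    Function.Surjective F.normInvariants := by
  rintro ⟨T, hT⟩
  obtain ⟨K, hK, hTK⟩ := (F.mem_compactSections_invariants_iff T).1 hT
  obtain ⟨s, hs⟩ := exists_norm_eq hfree hF ⊤ (F.ofInvariants T)
    (fun g _ => F.globalAct_ofInvariants T g) hK
    (fun x hx => let ⟨g, hg⟩ := hTK x hx; ⟨g, Subgroup.mem_top g, hg⟩)
  exact ⟨s, Subtype.ext (F.ofInvariants_injective hs)⟩

theorem nonempty_coinvariants_addEquiv (hfree : ∀ (g : G) (x : X), g • x = x → g = 1)
    (hF : IsSoft (generatedSupports (compactSweeps G X)) F.sheaf) :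
    Nonempty (Representation.Coinvariants
      (F.compactSectionsRho.comp (⊤ : Subgroup G).subtype) ≃+ compactSections F.invariants) := by
  let I := Representation.Coinvariants.ker (F.compactSectionsRho.comp (⊤ : Subgroup G).subtype)
  have hker : I.toAddSubgroup = F.normInvariants.ker := by
    ext s
    rw [AddMonoidHom.mem_ker, normInvariants_eq_zero_iff]
    exact ⟨norm_eq_zero_of_mem_ker ⊤, mem_ker_of_norm_eq_zero hfree hF ⊤ s⟩
  exact ⟨(QuotientAddGroup.quotientAddEquivOfEq hker).trans
    (QuotientAddGroup.quotientKerEquivOfSurjective F.normInvariants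
      (F.normInvariants_surjective hfree hF))⟩

end Coinvariants

end EquivariantSheaf

/-! ### The coordinate filtration of `ℤ^d` and the conclusion. -/

section FreeAbelian

variable {d : ℕ} {G : Type u} [CommGroup G] (e : G ≃* Multiplicative (Fin d → ℤ))

/-- The subgroup of the elements of `ℤ^d` whose coordinates from the `i`-th on vanish. -/
def coordinateSubgroup (i : ℕ) : Subgroup G where
  carrier := {g | ∀ j : Fin d, i ≤ j → (e g).toAdd j = 0}
  one_mem' := by simp
  mul_mem' {a b} ha hb j hj := by simp [ha j hj, hb j hj]
  inv_mem' {a} ha j hj := by simp [ha j hj]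

theorem coordinateSubgroup_zero : coordinateSubgroup e 0 = ⊥ := by
  refine le_bot_iff.1 fun g hg => Subgroup.mem_bot.2 (e.injective ?_)
  rw [map_one]
  exact Multiplicative.toAdd.injective (funext fun j => hg j (Nat.zero_le _))

theorem coordinateSubgroup_self : coordinateSubgroup e d = ⊤ :=
  eq_top_iff.2 fun _ _ j hj => absurd j.2 (not_lt.2 hj)

/-- The `i`-th basis element of a free abelian group (and `1` if `i` is out of range). -/
def basisElement (i : ℕ) : G :=
  if h : i < d then e.symm (Multiplicative.ofAdd (Pi.single ⟨i, h⟩ 1)) else 1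

theorem toAdd_basisElement_zpow {i : ℕ} (h : i < d) (n : ℤ) (j : Fin d) :
    (e (basisElement e i ^ n)).toAdd j = if j = ⟨i, h⟩ then n else 0 := by
  rw [basisElement, dif_pos h, map_zpow, MulEquiv.apply_symm_apply, toAdd_zpow, toAdd_ofAdd]
  simp [Pi.single_apply]

theorem coordinateSubgroup_succ {i : ℕ} (h : i < d) :
    coordinateSubgroup e (i + 1) =
      coordinateSubgroup e i ⊔ Subgroup.zpowers (basisElement e i) := by
  refine le_antisymm (fun g hg => ?_) (sup_le (fun g hg j hj => hg j (by omega)) ?_)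
  · rw [← mul_inv_cancel_right g (basisElement e i ^ (e g).toAdd ⟨i, h⟩)⁻¹, inv_inv]
    refine Subgroup.mul_mem_sup (fun j hj => ?_) (Subgroup.zpow_mem_zpowers _ _)
    rw [map_mul, map_inv, toAdd_mul, toAdd_inv, Pi.add_apply, Pi.neg_apply,
      toAdd_basisElement_zpow e h]
    split_ifs with hji
    · rw [hji, add_neg_cancel]
    · rw [hg j (lt_of_le_of_ne hj fun h0 => hji (Fin.ext h0.symm)), neg_zero, add_zero]
  · refine Subgroup.zpowers_le.2 fun j hj => ?_
    have h1 := toAdd_basisElement_zpow e h 1 j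
    rw [zpow_one, if_neg] at h1
    · exact h1
    · rintro rfl
      exact absurd hj (by simp)

theorem eq_zero_of_basisElement_zpow_mem {i : ℕ} (h : i < d) (n : ℤ)
    (hn : basisElement e i ^ n ∈ coordinateSubgroup e i) : n = 0 := by
  have h1 := hn ⟨i, h⟩ le_rfl
  rwa [toAdd_basisElement_zpow e h, if_pos rfl] at h1

-- Proper discontinuity makes the stabilizers finite, and a torsion-free group has no nontrivial
-- finite subgroup.
include e in
theorem eq_one_of_smul_eq {X : Type u} [TopologicalSpace X] [MulAction G X]
    [ProperlyDiscontinuousSMul G X] (g : G) (x : X) (hx : g • x = x) : g = 1 := by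
  have hfin := ProperlyDiscontinuousSMul.finite_stabilizer (Γ := G) x
  have hg : g ∈ MulAction.stabilizer G x := hx
  have : Finite (MulAction.stabilizer G x) := hfin
  have h1 : IsOfFinOrder (⟨g, hg⟩ : MulAction.stabilizer G x) := isOfFinOrder_of_finite _
  obtain ⟨n, hn, h2⟩ := isOfFinOrder_iff_pow_eq_one.1 h1
  have h3 : g ^ n = 1 := congrArg Subtype.val h2
  refine e.injective (Multiplicative.toAdd.injective (funext fun j => ?_))
  have h4 := congrArg (fun a => (e a).toAdd j) h3
  simp only [map_pow, map_one, toAdd_pow, toAdd_one, Pi.smul_apply, Pi.zero_apply,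
    nsmul_eq_mul, mul_eq_zero, Nat.cast_eq_zero] at h4 ⊢
  exact h4.resolve_left hn.ne'

include e in
theorem EquivariantSheaf.groupCohomology_compactSectionsRep {X : Type u} [TopologicalSpace X]
    [T2Space X] [LocallyCompactSpace X] [MulAction G X] [ContinuousConstSMul G X]
    [ProperlyDiscontinuousSMul G X] (F : EquivariantSheaf G X)
    (hF : IsSoft (generatedSupports (compactSweeps G X)) F.sheaf) :
    (∀ p : ℕ, p ≠ d → Subsingleton (groupCohomology F.compactSectionsRep p)) ∧
      Nonempty (groupCohomology F.compactSectionsRep d ≃+ compactSections F.invariants) := by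
  have hfree : ∀ (g : G) (x : X), g • x = x → g = 1 := eq_one_of_smul_eq e
  obtain ⟨hlt, ⟨a⟩⟩ := F.compactSectionsRep.groupCohomology_of_regular (basisElement e)
    (coordinateSubgroup e) (coordinateSubgroup_zero e)
    (fun i hi => coordinateSubgroup_succ e hi) (coordinateSubgroup_self e)
    (fun i hi s hs => mem_ker_of_norm_eq_zero hfree hF _ s (norm_eq_zero_of_sub_mem_ker _
      (eq_zero_of_basisElement_zpow_mem e hi) s hs))
  obtain ⟨b⟩ := F.nonempty_coinvariants_addEquiv hfree hF
  refine ⟨fun p hp => ?_, ⟨a.trans b⟩⟩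
  rcases lt_or_gt_of_ne hp with h | h
  · exact ModuleCat.subsingleton_of_isZero (hlt p h)
  · exact ModuleCat.subsingleton_of_isZero
      (Rep.isZero_groupCohomology_of_lt d e F.compactSectionsRep p h)

end FreeAbelian

end

theorem mainTheorem1 (d : ℕ) {G : Type u} [Group G] [TopologicalSpace G] [DiscreteTopology G]
    (e : G ≃* Multiplicative (Fin d → ℤ))
    {X : Type u} [TopologicalSpace X] [T2Space X] [LocallyCompactSpace X]
    [MulAction G X] [ProperSMul G X]
    (F : EquivariantSheaf G X)
    (hF : IsSoft (generatedSupports (compactSweeps G X)) F.sheaf) :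
    (∀ p : ℕ, p ≠ d → Subsingleton (groupCohomology F.compactSectionsRep p)) ∧
      Nonempty (groupCohomology F.compactSectionsRep d ≃+ compactSections F.invariants) := by
  have : ProperlyDiscontinuousSMul G X := properlyDiscontinuousSMul_iff_properSMul.2 inferInstance
  -- Built on the given group structure, so that the cohomology and the action in the goal remain
  -- the same.
  let i : CommGroup G :=
    { ‹Group G› with mul_comm := fun a b => e.injective (by rw [map_mul, map_mul, mul_comm]) }
  exact EquivariantSheaf.groupCohomology_compactSectionsRep (G := G) e F hF
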